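/- **Setting (the BB84-INFO-$z$ protocol under a collective attack).** Let $|0^0\rangle,|1^0\rangle$ be the computational ($z$) basis of $\mathbb C^2$ and let $|0^1\rangle=\frac{|0^0\rangle+|1^0\rangle}{\sqrt2}$, $|1^1\rangle=\frac{|0^0\rangle-|1^0\rangle}{\sqrt2}$ be the $x$ basis. For a bit string $\mathbf s$, $|\mathbf s|$ is the number of its $1$-bits, and $d_H$ is the Hamming distance. Let $n,n_z,n_x\ge 1$, $N=n+n_z+n_x$, and let $v_1,\dots,v_{r+m}\in\mathbf F_2^n$ be linearly independent; $P_C$ is the $r\times n$ matrix with rows $v_1,\dots,v_r$, and $P_K$ is the $m\times n$ matrix with rows $v_{r+1},\dots,v_{r+m}$. Put $$d_{r,m}=\min_{r\le r'<r+m} d_H\bigl(v_{r'+1},\operatorname{Span}\{v_1,\dots,v_{r'}\}\bigr)\qquad(\min\emptyset=\infty).$$ Alice chooses uniformly at random a partition $\mathcal P=(\mathbf s,\mathbf z,\mathbf b)$, i.e. three strings in $\mathbf F_2^N$ with $|\mathbf s|=n$, $|\mathbf z|=n_z$, $|\mathbf b|=n_x$, $|\mathbf s+\mathbf z+\mathbf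 b|=N$, and, independently, a uniform string $\mathbf i\in\mathbf F_2^N$; she sends the qubits $|i_j^{b_j}\rangle$, $1\le j\le N$. Eve's collective attack is given by finite-dimensional probe spaces $E_j$, unit vectors $|0^E\rangle_{E_j}\in E_j$ and unitary operators $U_j$ on $E_j\otimes\mathbb C^2$, fixed before the protocol (so independent of $\mathbf i$ and $\mathcal P$): the $j$-th qubit and probe are brought into the state $U_j|0^E\rangle_{E_j}|i_j^{b_j}\rangle$, Eve keeps the probes, and the qubits go to Bob. Bob measures the $j$-th qubit in the $z$ basis if $b_j=0$ and in the $x$ basis if $b_j=1$, and obtains a string $\mathbf i^B$. Let $\mathbf c=\mathbf i+\mathbf i^B$, let $\mathbf c_{\mathbf z},\mathbf c_{\mathbf b}$ be its substrings on the positions where $z_j=1$, respectively $b_j=1$, let $\mathbf x=\mathbf i_{\mathbf s}\in\mathbf F_2^n$ be the substring of $\mathbf i$ on the positions where $s_j=1$, let $\boldsymbol\xi=\mathbf xP_C^{T}$ be the syndrome, and let $p(\mathcal P,\boldsymbol\xi,\mathbf c_{\mathbf z},\mathbf c_{\mathbf b})$ be the joint probability of these data. For $\mathbf x\in\mathbf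 F_2^n$ let $\rho_{\mathbf x}$ be the reduced state of the $n$ probes at the positions where $s_j=1$ if $\mathbf x$ was sent there (in the $z$ basis), and for $\mathbf k\in\mathbf F_2^m$ let $$\widehat\rho_{\mathbf k}=\frac1{2^{n-r-m}}\sum_{\mathbf x:\ \mathbf xP_C^T=\boldsymbol\xi,\ \mathbf xP_K^T=\mathbf k}\rho_{\mathbf x}.$$ For thresholds $p_{a,z},p_{a,x}$ define $\Delta_{\rm Eve}^{(p_{a,z},p_{a,x})}(\mathbf k,\mathbf k'\mid\mathcal P,\boldsymbol\xi,\mathbf c_{\mathbf z},\mathbf c_{\mathbf b})=\frac12\operatorname{tr}|\widehat\rho_{\mathbf k}-\widehat\rho_{\mathbf k'}|$ if $\frac{|\mathbf c_{\mathbf z}|}{n_z}\le p_{a,z}$ and $\frac{|\mathbf c_{\mathbf b}|}{n_x}\le p_{a,x}$, and $0$ otherwise, and $$\bigl\langle\Delta_{\rm Eve}^{(p_{a,z},p_{a,x})}(\mathbf k,\mathbf k')\bigr\rangle=\sum_{\mathcal P,\boldsymbol\xi,\mathbf c_{\mathbf z},\mathbf c_{\mathbf b}}\Delta_{\rm Eve}^{(p_{a,z},p_{a,x})}(\mathbf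 k,\mathbf k'\mid\mathcal P,\boldsymbol\xi,\mathbf c_{\mathbf z},\mathbf c_{\mathbf b})\;p(\mathcal P,\boldsymbol\xi,\mathbf c_{\mathbf z},\mathbf c_{\mathbf b}).$$ **Theorem.** Let $\delta>0$, $R>0$, and let, for every $n$ in some set $S\subseteq\mathbb N$ (for instance an infinite one), $v^n_1,\dots,v^n_{r_n+m_n}$ be linearly independent vectors in $\mathbf F_2^n$ such that $\delta<\frac{d_{r_n,m_n}}{n}$ and $\frac{m_n}{n}\le R$. Then for all $p_{a,z},p_{a,x}>0$ and $\epsilon_{\rm sec}>0$ with $p_{a,x}+\epsilon_{\rm sec}\le\frac\delta2$, all $n\in S$ and $n,n_z,n_x>0$, every collective attack of Eve, and any two keys $\mathbf k,\mathbf k'\in\mathbf F_2^{m_n}$, the protocol run with the vectors $v^n_1,\dots,v^n_{r_n+m_n}$ satisfies $$\bigl\langle\Delta_{\rm Eve}^{(p_{a,z},p_{a,x})}(\mathbf k,\mathbf k')\bigr\rangle\le 2R\,n\,e^{-\left(\frac{n_x}{n+n_x}\right)^2 n\,\epsilon_{\rm sec}^2}.$$ -/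

import Mathlib

open scoped BigOperators ENNReal

noncomputable section

namespace BB84InfoZ

/-! Bits are elements of `ZMod 2`, bit strings are functions `Fin t → ZMod 2`. -/

/-! ### Linear codes -/

/-- `d_{r,m} = min_{r ≤ r' < r+m} d_H(v_{r'+1}, Span {v_1, …, v_{r'}})`. The vectors are indexed from
`0` here, so `v_{r'+1}` is `v (Fin.natAdd r j)` with `r' = r + j`. The minimum of the empty
family (`m = 0`) is `⊤`. -/
def keyDist {n : ℕ} (r m : ℕ) (v : Fin (r + m) → Fin n → ZMod 2) : ℕ∞ :=
  ⨅ j : Fin m, ⨅ w ∈ Submodule.span (ZMod 2) (v '' {i | i < Fin.natAdd r j}),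
    (hammingDist (v (Fin.natAdd r j)) w : ℕ∞)

/-- The parity check matrix, whose rows are `v_1, …, v_r`. -/
def parityMatrix {n r m : ℕ} (v : Fin (r + m) → Fin n → ZMod 2) : Matrix (Fin r) (Fin n) (ZMod 2) :=
  Matrix.of fun a => v (Fin.castAdd m a)

/-- The privacy amplification matrix, whose rows are `v_{r+1}, …, v_{r+m}`. -/
def keyMatrix {n r m : ℕ} (v : Fin (r + m) → Fin n → ZMod 2) : Matrix (Fin m) (Fin n) (ZMod 2) :=
  Matrix.of fun a => v (Fin.natAdd r a)

/-! ### Qubits and collective attacks -/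

/-- The coordinates in the computational basis of the state `|i^b⟩`: `b = 0` is the `z` basis, and
for `b = 1` (the `x` basis) `|0^1⟩ = (|0⟩ + |1⟩) / √2` and `|1^1⟩ = (|0⟩ - |1⟩) / √2`. -/
def qubitState (b i : ZMod 2) : ZMod 2 → ℂ := fun t =>
  if b = 0 then (if t = i then 1 else 0)
  else (if i = 1 ∧ t = 1 then -1 else 1) / (Real.sqrt 2 : ℂ)

/-- An attack on one qubit, with probe space `ℂ^ι`: an initial unit vector `|0^E⟩` of the probe and
a unitary operator on the compound system of the probe and the qubit. -/
structure QubitAttack (ι : Type*) [Fintype ι] [DecidableEq ι] where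
  probe : ι → ℂ
  probe_unit : ∑ e, ‖probe e‖ ^ 2 = 1
  U : Matrix (ι × ZMod 2) (ι × ZMod 2) ℂ
  U_unitary : U ∈ Matrix.unitaryGroup (ι × ZMod 2) ℂ

/-- The state `U |0^E⟩ |i^b⟩` of the probe and the qubit after the attack. -/
def QubitAttack.output {ι : Type*} [Fintype ι] [DecidableEq ι] (A : QubitAttack ι)
    (b i : ZMod 2) : ι × ZMod 2 → ℂ :=
  A.U.mulVec fun p => A.probe p.1 * qubitState b i p.2

section Collective

variable {J : Type*} [Fintype J] [DecidableEq J] {ι : J → Type*} [∀ j, Fintype (ι j)]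
  [∀ j, DecidableEq (ι j)]

/-- The joint state `⨂_j U_j |0^E⟩ |i_j^{b_j}⟩` of the probes (coordinate `e`) and of
the qubits (coordinate `t`, in the computational basis) after the collective attack. -/
def jointState (A : ∀ j, QubitAttack (ι j)) (b i : J → ZMod 2) (e : ∀ j, ι j) (t : J → ZMod 2) : ℂ :=
  ∏ j, (A j).output (b j) (i j) (e j, t j)

/-- The probability (Born rule) that the measurement of all the qubits, the `j`-th one in the basis
`b_j`, gives the string `iB` if the string `i` was sent in the bases `b`. -/
def outcomeProb (A : ∀ j, QubitAttack (ι j)) (b i iB : J → ZMod 2) : ℝ :=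
  ∑ e : ∀ j, ι j,
    ‖∑ t : J → ZMod 2, star (∏ j, qubitState (b j) (iB j) (t j)) * jointState A b i e t‖ ^ 2

/-- The density matrix of the probes: the partial trace over the qubits of the joint state, if the
string `i` was sent in the bases `b`. -/
def eveState (A : ∀ j, QubitAttack (ι j)) (b i : J → ZMod 2) :
    Matrix (∀ j, ι j) (∀ j, ι j) ℂ :=
  Matrix.of fun e e' => ∑ t : J → ZMod 2, jointState A b i e t * star (jointState A b i e' t)

end Collective

/-- `tr |M|` with `|M| = √(Mᴴ M)`, that is, the sum of the square roots of the eigenvalues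
of `Mᴴ M`, with multiplicity. -/
def traceNorm {κ : Type*} [Fintype κ] [DecidableEq κ] (M : Matrix κ κ ℂ) : ℝ :=
  ∑ a, Real.sqrt ((Matrix.isHermitian_conjTranspose_mul_self M).eigenvalues a)

/-! ### The protocol -/

/-- The partitions `(s, z, b)` of the `N = n + nz + nx` positions: three `N`-bit strings
with `|s| = n`, `|z| = nz`, `|b| = nx` and `|s + z + b| = N`. -/
abbrev BitPartition (n nz nx : ℕ) : Type :=
  {P : (Fin (n + nz + nx) → ZMod 2) × (Fin (n + nz + nx) → ZMod 2) × (Fin (n + nz + nx) → ZMod 2) //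
    hammingNorm P.1 = n ∧ hammingNorm P.2.1 = nz ∧ hammingNorm P.2.2 = nx ∧
      hammingNorm (P.1 + P.2.1 + P.2.2) = n + nz + nx}

/-- The increasing enumeration of the positions of the `1`-bits of `s`. -/
def positions {N k : ℕ} (s : Fin N → ZMod 2) (h : hammingNorm s = k) : Fin k → Fin N :=
  (Finset.univ.filter fun j => s j ≠ 0).orderEmbOfFin h

section Protocol

variable {n nz nx : ℕ}

/-- The positions of the INFO bits. -/
def infoPos (P : BitPartition n nz nx) : Fin n → Fin (n + nz + nx) := positions P.1.1 P.2.1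

/-- The positions of the TEST-Z bits. -/
def testZPos (P : BitPartition n nz nx) : Fin nz → Fin (n + nz + nx) := positions P.1.2.1 P.2.2.1

/-- The positions of the TEST-X bits. -/
def testXPos (P : BitPartition n nz nx) : Fin nx → Fin (n + nz + nx) := positions P.1.2.2 P.2.2.2.1

variable {ι : Fin (n + nz + nx) → Type*} [∀ j, Fintype (ι j)] [∀ j, DecidableEq (ι j)]

/-- The probability that the partition `P = (s, z, b)` and the string `i` are chosen by Alice
(uniformly and independently) and that Bob, measuring in the bases `b`, obtains `iB`. -/
def protocolProb (A : ∀ j, QubitAttack (ι j)) (P : BitPartition n nz nx)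
    (i iB : Fin (n + nz + nx) → ZMod 2) : ℝ :=
  (Fintype.card (BitPartition n nz nx) : ℝ)⁻¹ * ((2 : ℝ) ^ (n + nz + nx))⁻¹ *
    outcomeProb A P.1.2.2 i iB

variable {r m : ℕ}

/-- `p(P, ξ, c_z, c_b)`: the probability of the partition `P`, the syndrome `ξ` of the INFO string,
and the error strings `cz` on the TEST-Z bits and `cb` on the TEST-X bits. -/
def publicProb (v : Fin (r + m) → Fin n → ZMod 2) (A : ∀ j, QubitAttack (ι j))
    (P : BitPartition n nz nx) (ξ : Fin r → ZMod 2) (cz : Fin nz → ZMod 2)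
    (cb : Fin nx → ZMod 2) : ℝ :=
  ∑ i : Fin (n + nz + nx) → ZMod 2, ∑ iB : Fin (n + nz + nx) → ZMod 2,
    if Matrix.vecMul (i ∘ infoPos P) (parityMatrix v).transpose = ξ ∧
        (i + iB) ∘ testZPos P = cz ∧ (i + iB) ∘ testXPos P = cb
    then protocolProb A P i iB else 0

/-- Eve's state on the probes of the INFO qubits given the syndrome `ξ` and the final key `k`:
`2^{-(n-r-m)} ∑ ρ_x^{b'}` over the strings `x` with syndrome `ξ` and key `k`, where `b' = b_s`. -/
def eveKeyState (v : Fin (r + m) → Fin n → ZMod 2) (A : ∀ j, QubitAttack (ι j))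
    (P : BitPartition n nz nx) (ξ : Fin r → ZMod 2) (k : Fin m → ZMod 2) :
    Matrix (∀ a, ι (infoPos P a)) (∀ a, ι (infoPos P a)) ℂ :=
  ((2 : ℂ) ^ (n - (r + m)))⁻¹ •
    ∑ x : Fin n → ZMod 2,
      if Matrix.vecMul x (parityMatrix v).transpose = ξ ∧
          Matrix.vecMul x (keyMatrix v).transpose = k
      then eveState (fun a => A (infoPos P a)) (P.1.2.2 ∘ infoPos P) x else 0

/-- `Δ_Eve(k, k' | P, ξ, c_z, c_b)`: the trace distance between Eve's states for the keys `k` and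
`k'` if the test is passed, and `0` otherwise. -/
def deltaEve (v : Fin (r + m) → Fin n → ZMod 2) (A : ∀ j, QubitAttack (ι j)) (paz pax : ℝ)
    (k k' : Fin m → ZMod 2) (P : BitPartition n nz nx) (ξ : Fin r → ZMod 2)
    (cz : Fin nz → ZMod 2) (cb : Fin nx → ZMod 2) : ℝ :=
  if (hammingNorm cz : ℝ) / nz ≤ paz ∧ (hammingNorm cb : ℝ) / nx ≤ pax
  then 1 / 2 * traceNorm (eveKeyState v A P ξ k - eveKeyState v A P ξ k') else 0

/-- The expected value `⟨Δ_Eve(k, k')⟩`. -/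
def expectedDelta (v : Fin (r + m) → Fin n → ZMod 2) (A : ∀ j, QubitAttack (ι j)) (paz pax : ℝ)
    (k k' : Fin m → ZMod 2) : ℝ :=
  ∑ P : BitPartition n nz nx, ∑ ξ : Fin r → ZMod 2, ∑ cz : Fin nz → ZMod 2,
    ∑ cb : Fin nx → ZMod 2, deltaEve v A paz pax k k' P ξ cz cb * publicProb v A P ξ cz cb

end Protocol

end BB84InfoZ

end

noncomputable section

namespace BB84InfoZ

/-! ### Sampling without replacement -/

/-! The argument is complementarity: Eve learns about bits sent in the `z` basis only as far as her
attack would cause errors in the `x` basis. For one qubit, the probe states for the two bits have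
purifications `∑_c (-1)^{c x} η_c` with orthogonal `η_c`, where `‖η_c‖²` is the probability of the
error `c` had the qubit been sent and measured in the `x` basis
(`QubitAttack.exists_orthogonal_modes`). Tensor products give modes `H c` indexed by error strings
(`exists_joint_orthogonal_modes`).

Discard the modes with `|c| > t`. In trace norm this costs at most `2 √q` per state, `q` being the
probability of more than `t` such virtual `x` errors on the INFO bits. In the rest, `x` enters only
through characters `(-1)^{(c + c')·x}` with `|c + c'| ≤ 2 t < d_{r,m}`, and the average of such a
character over the strings with given syndrome and key does not depend on the key
(`sum_parityCoset_bitSign_eq`). Hence the trace distance for two keys is at most `2 √q`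
(`traceNorm_sub_le_of_keyDist`).

It remains to average `√q · T` over the partitions, `T` being the probability that TEST-X is passed.
Since `√q · T ≤ √(q T)`, Cauchy–Schwarz moves the average under the root. As the attack is
collective, `q T` is the probability that, with all qubits in the `x` basis, the INFO error rate
exceeds `pax + ε` while the TEST-X rate is at most `pax`. In this virtual experiment the law of the
error string does not depend on the partition, so the string can be fixed and the partition alone
taken as random. Hoeffding's bound without replacement (`card_filter_powersetCard_le`) gives `exp(-2
…)`, whose square root is the claimed exponential. The prefactor `2` is at most `2 R n` because `R n
≥ m ≥ 1`, unless `m = 0`, when there is only one key. -/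

lemma choose_mul_pow_le_choose_mul_pow {K M : ℕ} (h : K ≤ M) (l : ℕ) :
    K.choose l * M ^ l ≤ M.choose l * K ^ l := by
  have key : K.descFactorial l * M ^ l ≤ M.descFactorial l * K ^ l := by
    induction l with
    | zero => simp
    | succ l ih =>
      rw [Nat.descFactorial_succ, Nat.descFactorial_succ, pow_succ, pow_succ]
      -- Factor by factor, `(K - l) / (M - l) ≤ K / M`; truncated subtraction keeps the product form
      -- true for `l > K`.
      have h1 : (K - l) * M ≤ (M - l) * K := by
        rw [Nat.sub_mul, Nat.sub_mul, Nat.mul_comm K M]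
        exact Nat.sub_le_sub_left (Nat.mul_le_mul_left l h) _
      calc (K - l) * K.descFactorial l * (M ^ l * M)
          = ((K - l) * M) * (K.descFactorial l * M ^ l) := by ring
        _ ≤ ((M - l) * K) * (M.descFactorial l * K ^ l) := Nat.mul_le_mul h1 ih
        _ = _ := by ring
  rw [Nat.descFactorial_eq_factorial_mul_choose, Nat.descFactorial_eq_factorial_mul_choose,
    mul_assoc, mul_assoc] at key
  exact Nat.le_of_mul_le_mul_left key (Nat.factorial_pos l)

/-- The moment generating function of the hypergeometric distribution is at most that of
the binomial distribution with the same mean. -/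
lemma sum_powersetCard_pow_card_inter_le {α : Type*} [DecidableEq α] {Q K : Finset α} (hK : K ⊆ Q)
    (n : ℕ) {y : ℝ} (hy : 0 ≤ y) :
    ∑ S ∈ Q.powersetCard n, (1 + y) ^ (S ∩ K).card ≤
      (Q.card.choose n : ℝ) * (1 + y * ((K.card : ℝ) / Q.card)) ^ n := by
  set M := Q.card with hM
  set k := K.card with hk
  have hkM : k ≤ M := Finset.card_le_card hK
  -- Number of `n`-sets containing a given `l`-set. The guard matters: for `l > n` truncated
  -- subtraction would give `choose _ 0 = 1` instead of `0`.
  set g : ℕ → ℝ := fun l => if l ≤ n then ((M - l).choose (n - l) : ℝ) else 0 with hg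
  have hcount : ∀ L ∈ K.powerset,
      (((Q.powersetCard n).filter fun S => L ⊆ S).card : ℝ) = g L.card := by
    intro L hL
    have hLQ : L ⊆ Q := (Finset.mem_powerset.1 hL).trans hK
    by_cases hl : L.card ≤ n
    · rw [hg]
      simp only [hl, if_true]
      congr 1
      rw [Finset.card_filter_powersetCard_subset]
      all_goals assumption
    · rw [hg]
      simp only [hl, if_false, Nat.cast_eq_zero, Finset.card_eq_zero]
      refine Finset.filter_eq_empty_iff.2 fun S hS hLS => hl ?_
      rw [← (Finset.mem_powersetCard.1 hS).2]
      exact Finset.card_le_card hLS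
  -- Comparison of factorial moments: `choose k l / choose M l ≤ (k / M) ^ l`. It passes to the
  -- generating functions because the coefficients `y ^ l` are nonnegative.
  have hterm : ∀ l, (k.choose l : ℝ) * (y ^ l * g l) ≤
      (M.choose n : ℝ) * ((y * ((k : ℝ) / M)) ^ l * (n.choose l : ℝ)) := by
    intro l
    by_cases hl : l ≤ n
    · simp only [hg, hl, if_true]
      rcases Nat.eq_zero_or_pos M with h0 | hMpos
      · have : k = 0 := by omega
        rw [this, h0]
        rcases Nat.eq_zero_or_pos l with rfl | hlpos
        · simp
        · simp [Nat.choose_eq_zero_of_lt hlpos]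
          positivity
      · have h1 : (k.choose l : ℝ) * (M : ℝ) ^ l ≤ (M.choose l : ℝ) * (k : ℝ) ^ l := by
          exact_mod_cast choose_mul_pow_le_choose_mul_pow hkM l
        have h2 : (M.choose n : ℝ) * (n.choose l : ℝ)
            = (M.choose l : ℝ) * ((M - l).choose (n - l) : ℝ) := by
          exact_mod_cast Nat.choose_mul (n := M) hl
        have hM' : (0 : ℝ) < (M : ℝ) ^ l := by positivity
        have h3 : (k.choose l : ℝ) ≤ (M.choose l : ℝ) * ((k : ℝ) / M) ^ l := by
          rw [div_pow, ← mul_div_assoc, le_div_iff₀ hM']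
          exact h1
        calc (k.choose l : ℝ) * (y ^ l * ((M - l).choose (n - l) : ℝ))
            ≤ ((M.choose l : ℝ) * ((k : ℝ) / M) ^ l) * (y ^ l * ((M - l).choose (n - l) : ℝ)) := by
              gcongr
          _ = ((M.choose l : ℝ) * ((M - l).choose (n - l) : ℝ)) * (((k : ℝ) / M) ^ l * y ^ l) := by
              ring
          _ = _ := by rw [← h2, mul_pow]; ring
    · simp only [hg, hl, if_false, mul_zero]
      positivity
  calc ∑ S ∈ Q.powersetCard n, (1 + y) ^ (S ∩ K).card
      = ∑ S ∈ Q.powersetCard n, ∑ L ∈ K.powerset, if L ⊆ S then y ^ L.card else 0 := by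
        refine Finset.sum_congr rfl fun S _ => ?_
        rw [add_comm, ← Finset.sum_pow_mul_eq_add_pow, ← Finset.sum_filter]
        simp only [one_pow, mul_one]
        refine Finset.sum_congr ?_ fun _ _ => rfl
        ext L
        simp only [Finset.mem_powerset, Finset.mem_filter, Finset.subset_inter_iff]
        tauto
    _ = ∑ L ∈ K.powerset, y ^ L.card * g L.card := by
        rw [Finset.sum_comm]
        refine Finset.sum_congr rfl fun L hL => ?_
        rw [← Finset.sum_filter, Finset.sum_const, nsmul_eq_mul, hcount L hL, mul_comm]
    _ = ∑ l ∈ Finset.range (k + 1), (k.choose l : ℝ) * (y ^ l * g l) := by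
        rw [Finset.sum_powerset_apply_card (fun l => y ^ l * g l)]
        simp only [nsmul_eq_mul, hk]
    _ ≤ ∑ l ∈ Finset.range (n + k + 1),
          (M.choose n : ℝ) * ((y * ((k : ℝ) / M)) ^ l * (n.choose l : ℝ)) := by
        refine (Finset.sum_le_sum fun l _ => hterm l).trans ?_
        refine Finset.sum_le_sum_of_subset_of_nonneg ?_ fun l _ _ => by positivity
        exact Finset.range_mono (by omega)
    _ = ∑ l ∈ Finset.range (n + 1),
          (M.choose n : ℝ) * ((y * ((k : ℝ) / M)) ^ l * (n.choose l : ℝ)) := by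
        symm
        refine Finset.sum_subset (Finset.range_mono (by omega)) fun l _ hl => ?_
        have hl' : n.choose l = 0 := Nat.choose_eq_zero_of_lt (by simpa using hl)
        rw [hl']
        simp
    _ = _ := by
        rw [← Finset.mul_sum, add_comm (1 : ℝ), add_pow]
        simp

/-- Hoeffding's lemma for a Bernoulli variable. -/
lemma one_add_exp_sub_one_mul_le {p : ℝ} (h0 : 0 ≤ p) (h1 : p ≤ 1) (t : ℝ) :
    1 + (Real.exp t - 1) * p ≤ Real.exp (t * p + t ^ 2 / 8) := by
  -- The Bernoulli law of parameter `p`. Being supported in `[0, 1]`, it is, once centred,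
  -- sub-Gaussian with variance proxy `(1/2)²`, whence `t² / 8`.
  let μ : MeasureTheory.Measure ℝ :=
    ENNReal.ofReal p • MeasureTheory.Measure.dirac 1 +
      ENNReal.ofReal (1 - p) • MeasureTheory.Measure.dirac 0
  have hprob : MeasureTheory.IsProbabilityMeasure μ := ⟨by
    simp only [μ, MeasureTheory.Measure.add_apply, MeasureTheory.Measure.smul_apply,
      MeasureTheory.measure_univ, smul_eq_mul, mul_one]
    rw [← ENNReal.ofReal_add h0 (by linarith)]
    simp⟩
  have hint : ∀ f : ℝ → ℝ, ∫ x, f x ∂μ = p * f 1 + (1 - p) * f 0 := by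
    intro f
    have hi : ∀ (a : ℝ) (c : ℝ), MeasureTheory.Integrable f
        (ENNReal.ofReal c • MeasureTheory.Measure.dirac a) := fun a c =>
      (MeasureTheory.integrable_dirac (by simp)).smul_measure ENNReal.ofReal_ne_top
    rw [MeasureTheory.integral_add_measure (hi _ _) (hi _ _), MeasureTheory.integral_smul_measure,
      MeasureTheory.integral_smul_measure, MeasureTheory.integral_dirac,
      MeasureTheory.integral_dirac, ENNReal.toReal_ofReal h0,
      ENNReal.toReal_ofReal (by linarith), smul_eq_mul, smul_eq_mul]
  have hae : ∀ᵐ x ∂μ, (id x : ℝ) ∈ Set.Icc (0 : ℝ) 1 := by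
    rw [MeasureTheory.ae_add_measure_iff]
    constructor
    · refine MeasureTheory.Measure.ae_smul_measure ?_ _
      simp [MeasureTheory.ae_dirac_eq]
    · refine MeasureTheory.Measure.ae_smul_measure ?_ _
      simp [MeasureTheory.ae_dirac_eq]
  have hsg := (ProbabilityTheory.hasSubgaussianMGF_of_mem_Icc (μ := μ) (X := id)
    measurable_id.aemeasurable hae).mgf_le t
  rw [ProbabilityTheory.mgf, hint, hint] at hsg
  simp only [id, mul_one, mul_zero, add_zero, sub_zero, zero_sub, nnnorm_one] at hsg
  have h4 : (((1 : NNReal) / 2) ^ 2 : NNReal) * t ^ 2 / 2 = t ^ 2 / 8 := by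
    push_cast; ring
  rw [h4] at hsg
  rw [Real.exp_add]
  have hpos := Real.exp_pos (t * p)
  have e1 : Real.exp (t * (1 - p)) = Real.exp t / Real.exp (t * p) := by
    rw [← Real.exp_sub]; ring_nf
  have e2 : Real.exp (t * -p) = 1 / Real.exp (t * p) := by
    rw [mul_neg, Real.exp_neg, one_div]
  rw [e1, e2] at hsg
  calc 1 + (Real.exp t - 1) * p
      = Real.exp (t * p) *
        (p * (Real.exp t / Real.exp (t * p)) + (1 - p) * (1 / Real.exp (t * p))) := by
        field_simp; ring
    _ ≤ _ := by gcongr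

/-- Hoeffding's bound for sampling without replacement, for a `0`-`1` population: if `n` elements
are drawn from `Q` and `K ⊆ Q`, then the proportion of elements of `K` in the sample exceeds
the one in the rest by `ε` with exponentially small probability. -/
lemma card_filter_powersetCard_le {α : Type*} [DecidableEq α] {Q K : Finset α} (hK : K ⊆ Q)
    {n l : ℕ} (hn : 0 < n) (hl : 0 < l) (hQ : Q.card = n + l) {ε : ℝ} (hε : 0 ≤ ε) :
    (((Q.powersetCard n).filter fun S =>
        ε ≤ ((S ∩ K).card : ℝ) / n - ((K \ S).card : ℝ) / l).card : ℝ) ≤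
      (Q.powersetCard n).card *
        Real.exp (-(2 * (((l : ℝ) / ((n : ℝ) + (l : ℝ))) ^ 2 * n * ε ^ 2))) := by
  have hn' : (0 : ℝ) < n := by exact_mod_cast hn
  have hl' : (0 : ℝ) < l := by exact_mod_cast hl
  -- An excess `ε` of the sample rate over the rate in the rest is an excess `l / (n + l) * ε` over
  -- the population mean `μ`.
  set t : ℝ := (l : ℝ) / ((n : ℝ) + l) * ε with ht
  have ht0 : 0 ≤ t := by positivity
  set μ : ℝ := (K.card : ℝ) / Q.card with hμ
  have hQ' : (Q.card : ℝ) = n + l := by rw [hQ]; push_cast; ring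
  have hμ0 : 0 ≤ μ := by positivity
  have hμ1 : μ ≤ 1 := by
    rw [hμ, div_le_one (by rw [hQ']; positivity)]
    exact_mod_cast Finset.card_le_card hK
  -- Minimises the Chernoff exponent per draw, `-lam * t + lam² / 8`, with value `-2 t²`.
  set lam : ℝ := 4 * t with hlam
  have hmarkov : ∀ S ∈ (Q.powersetCard n).filter fun S =>
        ε ≤ ((S ∩ K).card : ℝ) / n - ((K \ S).card : ℝ) / l,
      (1 : ℝ) ≤ Real.exp (-(lam * (n * (μ + t)))) * (1 + (Real.exp lam - 1)) ^ (S ∩ K).card := by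
    intro S hS
    have hS' := (Finset.mem_filter.1 hS).2
    have hsum : ((S ∩ K).card : ℝ) + (K \ S).card = K.card := by
      rw [Finset.inter_comm]
      exact_mod_cast Finset.card_inter_add_card_sdiff K S
    rw [add_sub_cancel, ← Real.exp_nat_mul, ← Real.exp_add]
    refine Real.one_le_exp ?_
    have h1 : n * (μ + t) ≤ ((S ∩ K).card : ℝ) := by
      rw [hμ, ht, hQ', ← hsum]
      set X := ((S ∩ K).card : ℝ)
      set Y := ((K \ S).card : ℝ)
      have h2 : (n : ℝ) * ((X + Y) / (n + l) + l / (n + l) * ε)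
          ≤ n * ((X + Y) / (n + l) + l / (n + l) * (X / n - Y / l)) := by gcongr
      refine h2.trans (le_of_eq ?_)
      field_simp
      ring
    have := mul_le_mul_of_nonneg_left h1 (show 0 ≤ lam by positivity)
    linarith
  calc (((Q.powersetCard n).filter fun S =>
        ε ≤ ((S ∩ K).card : ℝ) / n - ((K \ S).card : ℝ) / l).card : ℝ)
      = ∑ S ∈ (Q.powersetCard n).filter fun S =>
        ε ≤ ((S ∩ K).card : ℝ) / n - ((K \ S).card : ℝ) / l, (1 : ℝ) := by simp
    _ ≤ ∑ S ∈ (Q.powersetCard n).filter fun S =>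
        ε ≤ ((S ∩ K).card : ℝ) / n - ((K \ S).card : ℝ) / l,
        Real.exp (-(lam * (n * (μ + t)))) * (1 + (Real.exp lam - 1)) ^ (S ∩ K).card :=
        Finset.sum_le_sum hmarkov
    _ ≤ ∑ S ∈ Q.powersetCard n,
        Real.exp (-(lam * (n * (μ + t)))) * (1 + (Real.exp lam - 1)) ^ (S ∩ K).card := by
        refine Finset.sum_le_sum_of_subset_of_nonneg (Finset.filter_subset _ _) fun _ _ _ => ?_
        rw [add_sub_cancel]
        positivity
    _ ≤ Real.exp (-(lam * (n * (μ + t)))) *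
        ((Q.powersetCard n).card * (1 + (Real.exp lam - 1) * μ) ^ n) := by
        rw [← Finset.mul_sum, Finset.card_powersetCard]
        refine mul_le_mul_of_nonneg_left ?_ (Real.exp_pos _).le
        refine sum_powersetCard_pow_card_inter_le hK n ?_
        have := Real.one_le_exp (show 0 ≤ lam by positivity)
        linarith
    _ ≤ Real.exp (-(lam * (n * (μ + t)))) *
        ((Q.powersetCard n).card * Real.exp (lam * μ + lam ^ 2 / 8) ^ n) := by
        gcongr
        · have := Real.one_le_exp (show 0 ≤ lam by positivity)
          have : 0 ≤ (Real.exp lam - 1) * μ := mul_nonneg (by linarith) hμ0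
          linarith
        · exact one_add_exp_sub_one_mul_le hμ0 hμ1 lam
    _ = _ := by
        rw [← Real.exp_nat_mul, mul_left_comm, ← Real.exp_add]
        congr 2
        rw [hlam, ht]
        ring

/-! ### Duality for the trace norm -/

section TraceNorm

open Matrix

open scoped ComplexOrder

lemma sum_norm_sq_eq_re_dotProduct {κ : Type*} [Fintype κ] (y : κ → ℂ) :
    ∑ e, ‖y e‖ ^ 2 = (star y ⬝ᵥ y).re := by
  simp only [dotProduct, Pi.star_apply, Complex.re_sum]
  refine Finset.sum_congr rfl fun e _ => ?_
  rw [RCLike.star_def, Complex.conj_mul', ← Complex.ofReal_pow, Complex.ofReal_re]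

/-- The trace norm of `M` is `tr (W M)` for some `W` whose adjoint is a contraction. -/
lemma exists_traceNorm_eq_trace_mul {κ : Type*} [Fintype κ] [DecidableEq κ] (M : Matrix κ κ ℂ) :
    ∃ W : Matrix κ κ ℂ, (∀ y : κ → ℂ, ∑ e, ‖(Wᴴ *ᵥ y) e‖ ^ 2 ≤ ∑ e, ‖y e‖ ^ 2) ∧
      (traceNorm M : ℂ) = (W * M).trace := by
  set hM := isHermitian_conjTranspose_mul_self M
  set U : Matrix κ κ ℂ := (hM.eigenvectorUnitary : Matrix κ κ ℂ) with hU
  have hUU : Uᴴ * U = 1 := by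
    have := Unitary.coe_star_mul_self hM.eigenvectorUnitary
    simpa [star_eq_conjTranspose] using this
  have hUU' : U * Uᴴ = 1 := by
    have := Unitary.coe_mul_star_self hM.eigenvectorUnitary
    simpa [star_eq_conjTranspose] using this
  have hspec : Mᴴ * M = U * diagonal (fun a => (hM.eigenvalues a : ℂ)) * Uᴴ := by
    have := hM.spectral_theorem
    rw [Unitary.conjStarAlgAut_apply] at this
    simpa [star_eq_conjTranspose, Function.comp_def] using this
  have hnn : ∀ a, 0 ≤ hM.eigenvalues a :=
    (posSemidef_conjTranspose_mul_self M).eigenvalues_nonneg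
  set s : κ → ℝ := fun a => Real.sqrt (hM.eigenvalues a) with hs
  -- Since `0⁻¹ = 0`, `U D Uᴴ` is the pseudo-inverse of `|M|`. With `W = U D Uᴴ Mᴴ`, `W M = |M|` and
  -- `W Wᴴ` is the projection onto the range of `|M|`.
  set D : Matrix κ κ ℂ := diagonal fun a => ((s a)⁻¹ : ℂ) with hD
  have hDH : Dᴴ = D := by
    rw [hD, diagonal_conjTranspose]
    congr 1
    ext a
    simp
  have hWM : U * D * Uᴴ * Mᴴ * M = U * diagonal (fun a => (s a : ℂ)) * Uᴴ := by
    rw [Matrix.mul_assoc _ Mᴴ M, hspec]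
    calc U * D * Uᴴ * (U * diagonal (fun a => (hM.eigenvalues a : ℂ)) * Uᴴ)
        = U * D * (Uᴴ * U) * diagonal (fun a => (hM.eigenvalues a : ℂ)) * Uᴴ := by
          simp only [Matrix.mul_assoc]
      _ = U * (D * diagonal (fun a => (hM.eigenvalues a : ℂ))) * Uᴴ := by
          rw [hUU, Matrix.mul_one]; simp only [Matrix.mul_assoc]
      _ = _ := by
          rw [hD, diagonal_mul_diagonal]
          congr 3
          ext a
          have h2 : hM.eigenvalues a = s a * s a := (Real.mul_self_sqrt (hnn a)).symm
          rw [h2]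
          by_cases h0 : s a = 0
          · simp [h0]
          · push_cast
            field_simp
  refine ⟨U * D * Uᴴ * Mᴴ, fun y => ?_, ?_⟩
  · have hWW : (U * D * Uᴴ * Mᴴ) * (U * D * Uᴴ * Mᴴ)ᴴ
        = U * diagonal (fun a => if s a = 0 then (0 : ℂ) else 1) * Uᴴ := by
      rw [conjTranspose_mul, conjTranspose_conjTranspose, ← Matrix.mul_assoc, hWM,
        conjTranspose_mul, conjTranspose_mul, conjTranspose_conjTranspose, hDH]
      calc U * diagonal (fun a => (s a : ℂ)) * Uᴴ * (U * (D * Uᴴ))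
          = U * diagonal (fun a => (s a : ℂ)) * (Uᴴ * U) * D * Uᴴ := by
            simp only [Matrix.mul_assoc]
        _ = U * (diagonal (fun a => (s a : ℂ)) * D) * Uᴴ := by
            rw [hUU, Matrix.mul_one]; simp only [Matrix.mul_assoc]
        _ = _ := by
            rw [hD, diagonal_mul_diagonal]
            congr 3
            ext a
            by_cases h0 : s a = 0
            · simp [h0]
            · simp [h0]
    have hnorm : ∀ (A : Matrix κ κ ℂ), star (A *ᵥ y) ⬝ᵥ (A *ᵥ y) = star y ⬝ᵥ ((Aᴴ * A) *ᵥ y) := by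
      intro A
      rw [star_mulVec, ← dotProduct_mulVec, mulVec_mulVec]
    have hyU : ∑ e, ‖y e‖ ^ 2 = ∑ e, ‖(Uᴴ *ᵥ y) e‖ ^ 2 := by
      rw [sum_norm_sq_eq_re_dotProduct, sum_norm_sq_eq_re_dotProduct, hnorm,
        conjTranspose_conjTranspose, hUU', one_mulVec]
    rw [hyU, sum_norm_sq_eq_re_dotProduct, hnorm, conjTranspose_conjTranspose, hWW,
      ← mulVec_mulVec, ← mulVec_mulVec, dotProduct_mulVec]
    have : star y ᵥ* U = star (Uᴴ *ᵥ y) := by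
      rw [star_mulVec, conjTranspose_conjTranspose]
    rw [this]
    simp only [dotProduct, mulVec_diagonal, Complex.re_sum]
    refine Finset.sum_le_sum fun e _ => ?_
    by_cases h0 : s e = 0
    · simp only [h0, if_true, zero_mul, mul_zero, Complex.zero_re]
      positivity
    · simp only [h0, if_false, one_mul, Pi.star_apply]
      rw [RCLike.star_def, Complex.conj_mul', ← Complex.ofReal_pow, Complex.ofReal_re]
  · rw [hWM, Matrix.trace_mul_comm, ← Matrix.mul_assoc, hUU, Matrix.one_mul, trace_diagonal,
      traceNorm]
    push_cast
    rfl

variable {κ τ : Type*} [Fintype τ]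

/-- The partial trace `tr_τ |f⟩⟨g|` of vectors in the tensor product of `ℂ^κ` and `ℂ^τ`. -/
def partialTrace (f g : κ → τ → ℂ) : Matrix κ κ ℂ :=
  Matrix.of fun e e' => ∑ t, f e t * star (g e' t)

lemma partialTrace_sub_left (f f' g : κ → τ → ℂ) :
    partialTrace (f - f') g = partialTrace f g - partialTrace f' g := by
  ext e e'
  simp [partialTrace, sub_mul, Finset.sum_sub_distrib]

lemma partialTrace_sub_right (f g g' : κ → τ → ℂ) :
    partialTrace f (g - g') = partialTrace f g - partialTrace f g' := by
  ext e e'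
  simp [partialTrace, mul_sub, Finset.sum_sub_distrib]

/-- The trace is the inner product of `f` with `(Wᴴ ⊗ 1) g`, so Cauchy–Schwarz applies; `Wᴴ`
contracts each slice `g · t`. -/
lemma norm_trace_mul_partialTrace_le [Fintype κ] {W : Matrix κ κ ℂ}
    (hW : ∀ y : κ → ℂ, ∑ e, ‖(Wᴴ *ᵥ y) e‖ ^ 2 ≤ ∑ e, ‖y e‖ ^ 2) (f g : κ → τ → ℂ) :
    ‖(W * partialTrace f g).trace‖ ≤
      Real.sqrt (∑ e, ∑ t, ‖f e t‖ ^ 2) * Real.sqrt (∑ e, ∑ t, ‖g e t‖ ^ 2) := by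
  have h1 : (W * partialTrace f g).trace =
      ∑ t, ∑ e, f e t * star ((Wᴴ *ᵥ fun e' => g e' t) e) := by
    simp only [Matrix.trace, Matrix.diag, Matrix.mul_apply, partialTrace, Matrix.of_apply,
      mulVec, dotProduct, star_sum, star_mul', conjTranspose_apply, star_star, Finset.mul_sum]
    rw [Finset.sum_comm]
    rw [Finset.sum_congr rfl fun e _ => Finset.sum_comm]
    rw [Finset.sum_comm]
    refine Finset.sum_congr rfl fun t _ => Finset.sum_congr rfl fun e _ =>
      Finset.sum_congr rfl fun e' _ => ?_
    ring
  have hC : ∑ t, ∑ e, ‖(Wᴴ *ᵥ fun e' => g e' t) e‖ ^ 2 ≤ ∑ e, ∑ t, ‖g e t‖ ^ 2 := by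
    rw [Finset.sum_comm (s := (Finset.univ : Finset κ))]
    exact Finset.sum_le_sum fun t _ => hW _
  rw [h1]
  calc ‖∑ t, ∑ e, f e t * star ((Wᴴ *ᵥ fun e' => g e' t) e)‖
      ≤ ∑ t, ∑ e, ‖f e t‖ * ‖(Wᴴ *ᵥ fun e' => g e' t) e‖ := by
        refine (norm_sum_le _ _).trans (Finset.sum_le_sum fun t _ => ?_)
        refine (norm_sum_le _ _).trans (Finset.sum_le_sum fun e _ => ?_)
        rw [norm_mul, norm_star]
    _ = ∑ p : τ × κ, ‖f p.2 p.1‖ * ‖(Wᴴ *ᵥ fun e' => g e' p.1) p.2‖ := by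
        rw [Fintype.sum_prod_type]
    _ ≤ Real.sqrt (∑ p : τ × κ, ‖f p.2 p.1‖ ^ 2) *
        Real.sqrt (∑ p : τ × κ, ‖(Wᴴ *ᵥ fun e' => g e' p.1) p.2‖ ^ 2) :=
        Real.sum_mul_le_sqrt_mul_sqrt _ _ _
    _ ≤ _ := by
        rw [Fintype.sum_prod_type, Fintype.sum_prod_type,
          Finset.sum_comm (s := (Finset.univ : Finset τ)) (f := fun t e => ‖f e t‖ ^ 2)]
        gcongr

end TraceNorm

/-! ### Attacks on one qubit -/

/-- The character `(-1)^a` of `ZMod 2`. -/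
def bitSign (a : ZMod 2) : ℂ := if a = 0 then 1 else -1

lemma bitSign_zero : bitSign 0 = 1 := by simp [bitSign]

lemma bitSign_one : bitSign 1 = -1 := by simp [bitSign]

lemma zmod_two_cases (a : ZMod 2) : a = 0 ∨ a = 1 := by
  fin_cases a
  · exact Or.inl rfl
  · exact Or.inr rfl

lemma zmod_two_add_self (a : ZMod 2) : a + a = 0 := CharTwo.add_self_eq_zero a

lemma bitSign_add (a b : ZMod 2) : bitSign (a + b) = bitSign a * bitSign b := by
  rcases zmod_two_cases a with rfl | rfl <;> rcases zmod_two_cases b with rfl | rfl <;>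
    simp [bitSign_zero, bitSign_one, zmod_two_add_self]

lemma bitSign_sum {α : Type*} (s : Finset α) (f : α → ZMod 2) :
    bitSign (∑ a ∈ s, f a) = ∏ a ∈ s, bitSign (f a) := by
  classical
  induction s using Finset.induction_on with
  | empty => simp [bitSign_zero]
  | insert a s ha ih => rw [Finset.sum_insert ha, Finset.prod_insert ha, bitSign_add, ih]

lemma star_bitSign (a : ZMod 2) : star (bitSign a) = bitSign a := by
  rcases zmod_two_cases a with rfl | rfl <;> simp [bitSign_zero, bitSign_one]

lemma bitSign_mul_self (a : ZMod 2) : bitSign a * bitSign a = 1 := by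
  rw [← bitSign_add, zmod_two_add_self, bitSign_zero]

lemma sum_zmod_two {M : Type*} [AddCommMonoid M] (f : ZMod 2 → M) : ∑ a, f a = f 0 + f 1 :=
  Fin.sum_univ_two f

lemma sqrt_two_mul_self : (Real.sqrt 2 : ℂ) * (Real.sqrt 2 : ℂ) = 2 := by
  rw [← Complex.ofReal_mul, Real.mul_self_sqrt (by norm_num)]
  norm_num

lemma sqrt_two_ne_zero : (Real.sqrt 2 : ℂ) ≠ 0 := by
  intro h
  have := sqrt_two_mul_self
  rw [h] at this
  norm_num at this

lemma normSq_div_sqrt_two (a : ℂ) : ‖a / (Real.sqrt 2 : ℂ)‖ ^ 2 = ‖a‖ ^ 2 / 2 := by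
  rw [norm_div, div_pow, Complex.norm_real, Real.norm_eq_abs, sq_abs, Real.sq_sqrt (by norm_num)]

lemma norm_add_sq_add_norm_sub_sq (a b : ℂ) :
    ‖a + b‖ ^ 2 + ‖a - b‖ ^ 2 = 2 * (‖a‖ ^ 2 + ‖b‖ ^ 2) := by
  have := parallelogram_law_with_norm ℝ a b
  nlinarith [this]

lemma qubitState_zero (i t : ZMod 2) : qubitState 0 i t = if t = i then 1 else 0 := by
  simp [qubitState]

lemma qubitState_one (i t : ZMod 2) :
    qubitState 1 i t = bitSign (i * t) / (Real.sqrt 2 : ℂ) := by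
  rcases zmod_two_cases i with rfl | rfl <;> rcases zmod_two_cases t with rfl | rfl <;>
    simp [qubitState, bitSign]

lemma sum_norm_qubitState_sq (b i : ZMod 2) : ∑ t, ‖qubitState b i t‖ ^ 2 = 1 := by
  rcases zmod_two_cases b with rfl | rfl
  · simp [qubitState_zero, apply_ite]
  · simp only [qubitState_one, normSq_div_sqrt_two, sum_zmod_two]
    rcases zmod_two_cases i with rfl | rfl <;> simp [bitSign] <;> norm_num

lemma sum_norm_sum_star_qubitState_mul_sq (b : ZMod 2) (f : ZMod 2 → ℂ) :
    ∑ i, ‖∑ t, star (qubitState b i t) * f t‖ ^ 2 = ∑ t, ‖f t‖ ^ 2 := by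
  rcases zmod_two_cases b with rfl | rfl
  · simp [qubitState_zero, apply_ite]
  · have h : ∀ i : ZMod 2, ∑ t, star (qubitState 1 i t) * f t =
        (f 0 + bitSign i * f 1) / (Real.sqrt 2 : ℂ) := by
      intro i
      rw [sum_zmod_two, qubitState_one, qubitState_one, mul_zero, mul_one, bitSign_zero,
        star_div₀, star_div₀, star_bitSign]
      simp only [star_one, RCLike.star_def, Complex.conj_ofReal]
      ring
    simp only [h, normSq_div_sqrt_two, sum_zmod_two, bitSign_zero, bitSign_one, one_mul, neg_one_mul,
      ← sub_eq_add_neg]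
    have := norm_add_sq_add_norm_sub_sq (f 0) (f 1)
    linarith

section Qubit

variable {ι : Type*} [Fintype ι] [DecidableEq ι]

lemma QubitAttack.sum_norm_output_sq (A : QubitAttack ι) (b i : ZMod 2) :
    ∑ e, ∑ t, ‖A.output b i (e, t)‖ ^ 2 = 1 := by
  rw [← Fintype.sum_prod_type (f := fun p => ‖A.output b i p‖ ^ 2), sum_norm_sq_eq_re_dotProduct,
    QubitAttack.output, Matrix.star_mulVec, ← Matrix.dotProduct_mulVec, Matrix.mulVec_mulVec]
  have hU : A.U.conjTranspose * A.U = 1 := by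
    have := Unitary.star_mul_self_of_mem A.U_unitary
    simpa [Matrix.star_eq_conjTranspose] using this
  rw [hU, Matrix.one_mulVec, ← sum_norm_sq_eq_re_dotProduct, Fintype.sum_prod_type]
  simp only [norm_mul, mul_pow]
  simp only [← Finset.mul_sum, sum_norm_qubitState_sq, mul_one, A.probe_unit]

lemma QubitAttack.output_one (A : QubitAttack ι) (i : ZMod 2) (p : ι × ZMod 2) :
    A.output 1 i p = (A.output 0 0 p + bitSign i * A.output 0 1 p) / (Real.sqrt 2 : ℂ) := by
  have h : (fun p : ι × ZMod 2 => A.probe p.1 * qubitState 1 i p.2) =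
      ((Real.sqrt 2 : ℂ))⁻¹ • ((fun p : ι × ZMod 2 => A.probe p.1 * qubitState 0 0 p.2) +
        bitSign i • (fun p : ι × ZMod 2 => A.probe p.1 * qubitState 0 1 p.2)) := by
    ext ⟨e, t⟩
    simp only [Pi.smul_apply, Pi.add_apply, smul_eq_mul, qubitState_one, qubitState_zero]
    rcases zmod_two_cases t with rfl | rfl
    · simp [bitSign_zero]; ring
    · simp; ring
  rw [QubitAttack.output, h, Matrix.mulVec_smul, Matrix.mulVec_add, Matrix.mulVec_smul]
  simp only [Pi.smul_apply, Pi.add_apply, smul_eq_mul, QubitAttack.output]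
  ring

/-- The probability that Bob obtains `iB` if `i` was sent and measured in the basis `b`. -/
def QubitAttack.bitProb (A : QubitAttack ι) (b i iB : ZMod 2) : ℝ :=
  ∑ e, ‖∑ t, star (qubitState b iB t) * A.output b i (e, t)‖ ^ 2

/-- The distribution of the error `i + iB` for a uniform bit `i` sent and measured in the basis
`b`. -/
def QubitAttack.flipProb (A : QubitAttack ι) (b c : ZMod 2) : ℝ :=
  1 / 2 * ∑ i, A.bitProb b i (i + c)

lemma QubitAttack.bitProb_nonneg (A : QubitAttack ι) (b i iB : ZMod 2) : 0 ≤ A.bitProb b i iB :=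
  Finset.sum_nonneg fun _ _ => by positivity

lemma QubitAttack.flipProb_nonneg (A : QubitAttack ι) (b c : ZMod 2) : 0 ≤ A.flipProb b c :=
  mul_nonneg (by norm_num) (Finset.sum_nonneg fun _ _ => A.bitProb_nonneg _ _ _)

lemma QubitAttack.sum_bitProb (A : QubitAttack ι) (b i : ZMod 2) : ∑ iB, A.bitProb b i iB = 1 := by
  simp only [QubitAttack.bitProb]
  rw [Finset.sum_comm, ← A.sum_norm_output_sq b i]
  exact Finset.sum_congr rfl fun e _ =>
    sum_norm_sum_star_qubitState_mul_sq b fun t => A.output b i (e, t)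

lemma QubitAttack.sum_flipProb (A : QubitAttack ι) (b : ZMod 2) : ∑ c, A.flipProb b c = 1 := by
  simp only [QubitAttack.flipProb]
  rw [← Finset.mul_sum, Finset.sum_comm]
  have h : ∀ i, ∑ c, A.bitProb b i (i + c) = 1 := fun i => by
    rw [← A.sum_bitProb b i]
    exact Equiv.sum_comp (Equiv.addLeft i) fun c => A.bitProb b i c
  simp [h]

/-- The amplitudes of an `x` error are half the difference and half the sum of two vectors, each a
component of the output for `0` minus that of the output for `1` with the qubit flipped. The
parallelogram law removes the cross terms, and polarisation turns squared distances into the real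
part of the overlap. -/
lemma QubitAttack.re_overlap (A : QubitAttack ι) :
    (∑ e, ∑ t, star (A.output 0 0 (e, t)) * A.output 0 1 (e, t + 1)).re =
      1 - 2 * A.flipProb 1 1 := by
  have hre : ∀ a b : ℂ, (star a * b).re = (‖a‖ ^ 2 + ‖b‖ ^ 2 - ‖a - b‖ ^ 2) / 2 := by
    intro a b
    have h1 : ∀ z : ℂ, ‖z‖ ^ 2 = z.re ^ 2 + z.im ^ 2 := fun z => by
      rw [← Complex.normSq_eq_norm_sq, Complex.normSq_apply]; ring
    rw [h1, h1, h1]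
    simp
    ring
  have hflip : A.flipProb 1 1 = 1 / 4 * ∑ e,
      (‖A.output 0 0 (e, 0) - A.output 0 1 (e, 1)‖ ^ 2 +
        ‖A.output 0 0 (e, 1) - A.output 0 1 (e, 0)‖ ^ 2) := by
    simp only [QubitAttack.flipProb, QubitAttack.bitProb, sum_zmod_two, zero_add, zmod_two_add_self]
    rw [← Finset.sum_add_distrib, Finset.mul_sum, Finset.mul_sum]
    refine Finset.sum_congr rfl fun e _ => ?_
    simp only [qubitState_one, A.output_one, mul_zero, mul_one, bitSign_zero, bitSign_one, one_mul,
      star_div₀, star_one, star_neg, RCLike.star_def, Complex.conj_ofReal]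
    set w := A.output 0 0 (e, 0)
    set x := A.output 0 0 (e, 1)
    set y := A.output 0 1 (e, 0)
    set z := A.output 0 1 (e, 1)
    have e1 : 1 / (Real.sqrt 2 : ℂ) * ((w + y) / (Real.sqrt 2 : ℂ)) +
        -1 / (Real.sqrt 2 : ℂ) * ((x + z) / (Real.sqrt 2 : ℂ)) = ((w - z) - (x - y)) / 2 := by
      rw [← sqrt_two_mul_self]
      have := sqrt_two_ne_zero
      field_simp
      ring
    have e2 : 1 / (Real.sqrt 2 : ℂ) * ((w + -1 * y) / (Real.sqrt 2 : ℂ)) +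
        1 / (Real.sqrt 2 : ℂ) * ((x + -1 * z) / (Real.sqrt 2 : ℂ)) = ((w - z) + (x - y)) / 2 := by
      rw [← sqrt_two_mul_self]
      have := sqrt_two_ne_zero
      field_simp
      ring
    rw [e1, e2, norm_div, norm_div, div_pow, div_pow, Complex.norm_ofNat]
    have := norm_add_sq_add_norm_sub_sq (w - z) (x - y)
    linarith
  have h0 := A.sum_norm_output_sq 0 0
  have h1 := A.sum_norm_output_sq 0 1
  simp only [sum_zmod_two] at h0 h1 ⊢
  rw [hflip, Complex.re_sum]
  simp only [Complex.add_re, hre, zero_add, zmod_two_add_self]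
  simp only [← Finset.sum_div, Finset.sum_add_distrib, Finset.sum_sub_distrib, add_div, sub_div]
    at h0 h1 ⊢
  linarith

/-- Purifications of the probe states for the two bits in the `z` basis, whose overlap is real and
determined by the error probability in the `x` basis. -/
lemma QubitAttack.exists_purification (A : QubitAttack ι) :
    ∃ φ : ZMod 2 → ι → ZMod 2 × Bool → ℂ,
      (∀ x, partialTrace (φ x) (φ x) =
        partialTrace (fun e t => A.output 0 x (e, t)) (fun e t => A.output 0 x (e, t))) ∧
      ∑ e, ∑ κ, star (φ 0 e κ) * φ 1 e κ = ((1 - 2 * A.flipProb 1 1 : ℝ) : ℂ) := by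
  set ω : ℂ := ∑ e, ∑ t, star (A.output 0 0 (e, t)) * A.output 0 1 (e, t + 1) with hω
  -- Flipping the qubit in the output for `1` leaves the probe state unchanged and gives the overlap
  -- `ω`. Scaling by a contraction `z` makes the overlap exactly `ω.re`. The missing norm `s` goes
  -- to the flag value `true`, orthogonal to the output for `0`, so the partial trace is still the
  -- same.
  obtain ⟨z, hz1, hz2⟩ : ∃ z : ℂ, ‖z‖ ≤ 1 ∧ z * ω = (ω.re : ℂ) := by
    by_cases h : ω = 0
    · exact ⟨0, by simp, by simp [h]⟩
    · refine ⟨(ω.re : ℂ) / ω, ?_, by field_simp⟩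
      rw [norm_div, div_le_one (norm_pos_iff.2 h), Complex.norm_real]
      exact Complex.abs_re_le_norm ω
  set s : ℝ := Real.sqrt (1 - ‖z‖ ^ 2) with hs
  have hzs : z * star z + (s : ℂ) * star (s : ℂ) = 1 := by
    have h1 : s * s = 1 - ‖z‖ ^ 2 := Real.mul_self_sqrt (by nlinarith [norm_nonneg z])
    rw [RCLike.star_def, Complex.mul_conj', Complex.conj_ofReal,
      ← Complex.ofReal_mul, h1]
    push_cast
    ring
  refine ⟨fun x e κ => if x = 0 then (if κ.2 = true then 0 else A.output 0 0 (e, κ.1))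
    else (if κ.2 = true then (s : ℂ) else z) * A.output 0 1 (e, κ.1 + 1), fun x => ?_, ?_⟩
  · ext e e'
    simp only [partialTrace, Matrix.of_apply, Fintype.sum_prod_type, Fintype.sum_bool, sum_zmod_two]
    rcases zmod_two_cases x with rfl | rfl
    · simp
    · simp only [one_ne_zero, if_false, if_true, Bool.false_eq_true, star_mul', zero_add,
        zmod_two_add_self]
      linear_combination (A.output 0 1 (e, 1) * star (A.output 0 1 (e', 1)) +
        A.output 0 1 (e, 0) * star (A.output 0 1 (e', 0))) * hzs
  · rw [← A.re_overlap, ← hω, ← hz2, hω, Finset.mul_sum]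
    refine Finset.sum_congr rfl fun e _ => ?_
    simp only [Fintype.sum_prod_type, Fintype.sum_bool, sum_zmod_two]
    simp
    ring

/-- A purification of the probe states for the bits `x` in the `z` basis, of the form
`∑_c (-1)^{c x} |η_c⟩`, where the `|η_c⟩` are orthogonal and `‖η_c‖²` is the probability of
the error `c` in the `x` basis. -/
lemma QubitAttack.exists_orthogonal_modes (A : QubitAttack ι) :
    ∃ η : ZMod 2 → ι → ZMod 2 × Bool → ℂ,
      (∀ x, partialTrace (fun e κ => ∑ c, bitSign (c * x) * η c e κ)
          (fun e κ => ∑ c, bitSign (c * x) * η c e κ) =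
        partialTrace (fun e t => A.output 0 x (e, t)) (fun e t => A.output 0 x (e, t))) ∧
      ∀ c c', ∑ e, ∑ κ, η c e κ * star (η c' e κ) =
        if c = c' then (A.flipProb 1 c : ℂ) else 0 := by
  obtain ⟨φ, hφ, hov⟩ := A.exists_purification
  have hnorm : ∀ x, ∑ e, ∑ κ, φ x e κ * star (φ x e κ) = 1 := by
    intro x
    have h1 := congrArg Matrix.trace (hφ x)
    simp only [Matrix.trace, Matrix.diag, partialTrace, Matrix.of_apply] at h1
    rw [h1]
    have h2 := A.sum_norm_output_sq 0 x
    have h3 : ∀ z : ℂ, z * star z = ((‖z‖ ^ 2 : ℝ) : ℂ) := fun z => by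
      rw [RCLike.star_def, Complex.mul_conj']; push_cast; rfl
    simp only [h3]
    exact_mod_cast h2
  have h10 : ∑ e, ∑ κ, φ 1 e κ * star (φ 0 e κ) = ((1 - 2 * A.flipProb 1 1 : ℝ) : ℂ) := by
    rw [← hov]
    simp only [mul_comm]
  have h01 : ∑ e, ∑ κ, φ 0 e κ * star (φ 1 e κ) = ((1 - 2 * A.flipProb 1 1 : ℝ) : ℂ) := by
    have := congrArg star h10
    simp only [star_sum, star_mul', star_star] at this
    rw [RCLike.star_def, Complex.conj_ofReal] at this
    rw [← this]
    exact Finset.sum_congr rfl fun e _ => Finset.sum_congr rfl fun κ _ => mul_comm _ _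
  have hflip : A.flipProb 1 0 = 1 - A.flipProb 1 1 := by
    have := A.sum_flipProb 1
    rw [sum_zmod_two] at this
    linarith
  -- Half the sum and half the difference of unit vectors with real overlap `1 - 2 p` are
  -- orthogonal, with squared norms `1 - p` and `p`.
  refine ⟨fun c e κ => (φ 0 e κ + bitSign c * φ 1 e κ) / 2, fun x => ?_, fun c c' => ?_⟩
  · rw [← hφ x]
    have h : (fun e κ => ∑ c, bitSign (c * x) * ((φ 0 e κ + bitSign c * φ 1 e κ) / 2)) = φ x := by
      ext e κ
      rw [sum_zmod_two]
      rcases zmod_two_cases x with rfl | rfl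
      · simp [bitSign_zero, bitSign_one]; ring
      · simp [bitSign_zero, bitSign_one]; ring
    rw [h]
  · have hexp : ∀ e κ, (φ 0 e κ + bitSign c * φ 1 e κ) / 2 *
        star ((φ 0 e κ + bitSign c' * φ 1 e κ) / 2) =
        1 / 4 * (φ 0 e κ * star (φ 0 e κ)) + bitSign c' / 4 * (φ 0 e κ * star (φ 1 e κ)) +
        bitSign c / 4 * (φ 1 e κ * star (φ 0 e κ)) +
        bitSign c * bitSign c' / 4 * (φ 1 e κ * star (φ 1 e κ)) := by
      intro e κ
      rw [star_div₀, star_add, star_mul', star_bitSign]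
      simp only [star_ofNat]
      ring
    simp only [hexp, Finset.sum_add_distrib, ← Finset.mul_sum, hnorm, h01, h10]
    rcases zmod_two_cases c with rfl | rfl <;> rcases zmod_two_cases c' with rfl | rfl <;>
      simp [bitSign_zero, bitSign_one, hflip] <;> ring

end Qubit

/-! ### Collective attacks -/

lemma sum_sum_prod_eq_prod_sum_sum {R J τ : Type*} [CommSemiring R] [Fintype J] [DecidableEq J]
    {ι : J → Type*} [∀ j, Fintype (ι j)] [Fintype τ] (F : ∀ j, ι j → τ → R) :
    ∑ e : ∀ j, ι j, ∑ κ : J → τ, ∏ j, F j (e j) (κ j) = ∏ j, ∑ e, ∑ κ, F j e κ := by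
  classical
  rw [Finset.prod_univ_sum, Fintype.piFinset_univ]
  refine Finset.sum_congr rfl fun e _ => ?_
  rw [Finset.prod_univ_sum, Fintype.piFinset_univ]

/-- The attack acts qubit by qubit, so products of one-qubit modes serve: their signs multiply to
the character of `c ⬝ᵥ x`, and orthogonality in one factor suffices. -/
lemma exists_joint_orthogonal_modes {J : Type*} [Fintype J] [DecidableEq J] {ι : J → Type*}
    [∀ j, Fintype (ι j)] [∀ j, DecidableEq (ι j)] (A : ∀ j, QubitAttack (ι j)) :
    ∃ H : (J → ZMod 2) → (∀ j, ι j) → (J → ZMod 2 × Bool) → ℂ,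
      (∀ x, eveState A 0 x = partialTrace (fun e κ => ∑ c, bitSign (c ⬝ᵥ x) * H c e κ)
        (fun e κ => ∑ c, bitSign (c ⬝ᵥ x) * H c e κ)) ∧
      ∀ c c', ∑ e, ∑ κ, H c e κ * star (H c' e κ) =
        if c = c' then ((∏ j, (A j).flipProb 1 (c j) : ℝ) : ℂ) else 0 := by
  choose η hη hη' using fun j => (A j).exists_orthogonal_modes
  refine ⟨fun c e κ => ∏ j, η j (c j) (e j) (κ j), fun x => ?_, fun c c' => ?_⟩
  · have hprod : ∀ (e : ∀ j, ι j) (κ : J → ZMod 2 × Bool),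
        ∑ c : J → ZMod 2, bitSign (c ⬝ᵥ x) * ∏ j, η j (c j) (e j) (κ j) =
          ∏ j, ∑ c, bitSign (c * x j) * η j c (e j) (κ j) := by
      intro e κ
      rw [Finset.prod_univ_sum, Fintype.piFinset_univ]
      refine Finset.sum_congr rfl fun c _ => ?_
      rw [dotProduct, bitSign_sum, Finset.prod_mul_distrib]
    ext e e'
    simp only [eveState, partialTrace, Matrix.of_apply, jointState, hprod, Pi.zero_apply, star_prod,
      ← Finset.prod_mul_distrib]
    have hj : ∀ j, ∑ t, (A j).output 0 (x j) (e j, t) * star ((A j).output 0 (x j) (e' j, t)) =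
        ∑ κ, (∑ c, bitSign (c * x j) * η j c (e j) κ) *
          star (∑ c, bitSign (c * x j) * η j c (e' j) κ) := by
      intro j
      have := congrFun (congrFun (hη j (x j)) (e j)) (e' j)
      exact this.symm
    have h1 := Finset.prod_univ_sum (fun _ : J => (Finset.univ : Finset (ZMod 2)))
      fun j t => (A j).output 0 (x j) (e j, t) * star ((A j).output 0 (x j) (e' j, t))
    have h2 := Finset.prod_univ_sum (fun _ : J => (Finset.univ : Finset (ZMod 2 × Bool)))
      fun j κ => (∑ c, bitSign (c * x j) * η j c (e j) κ) *
          star (∑ c, bitSign (c * x j) * η j c (e' j) κ)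
    rw [Fintype.piFinset_univ] at h1 h2
    rw [← h1, ← h2]
    exact Finset.prod_congr rfl fun j _ => hj j
  · simp only [star_prod, ← Finset.prod_mul_distrib]
    rw [sum_sum_prod_eq_prod_sum_sum fun j e κ => η j (c j) e κ * star (η j (c' j) e κ)]
    simp only [hη']
    split_ifs with h
    · subst h
      simp
    · obtain ⟨j, hj⟩ := Function.ne_iff.1 h
      exact Finset.prod_eq_zero (Finset.mem_univ j) (if_neg hj)

/-- Pythagoras: the signs have modulus one, so the norm does not depend on `x`. -/
lemma sum_norm_sq_sum_modes {J κ τ : Type*} [Fintype J] [Fintype κ] [Fintype τ]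
    {H : (J → ZMod 2) → κ → τ → ℂ}
    {p : (J → ZMod 2) → ℝ}
    (hH : ∀ c c', ∑ e, ∑ t, H c e t * star (H c' e t) = if c = c' then (p c : ℂ) else 0)
    (s : Finset (J → ZMod 2)) (x : J → ZMod 2) :
    ∑ e, ∑ t, ‖∑ c ∈ s, bitSign (c ⬝ᵥ x) * H c e t‖ ^ 2 = ∑ c ∈ s, p c := by
  have h3 : ∀ z : ℂ, ((‖z‖ ^ 2 : ℝ) : ℂ) = z * star z := fun z => by
    rw [RCLike.star_def, Complex.mul_conj']; push_cast; rfl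
  apply Complex.ofReal_injective
  push_cast only [Complex.ofReal_sum]
  simp only [h3, star_sum, star_mul', star_bitSign, Finset.sum_mul_sum]
  calc ∑ e, ∑ t, ∑ c ∈ s, ∑ c' ∈ s,
        bitSign (c ⬝ᵥ x) * H c e t * (bitSign (c' ⬝ᵥ x) * star (H c' e t))
      = ∑ c ∈ s, ∑ c' ∈ s, bitSign (c ⬝ᵥ x) * bitSign (c' ⬝ᵥ x) *
          ∑ e, ∑ t, H c e t * star (H c' e t) := by
        simp only [Finset.mul_sum]
        rw [Finset.sum_congr rfl fun e _ => Finset.sum_comm]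
        rw [Finset.sum_comm]
        refine Finset.sum_congr rfl fun c _ => ?_
        rw [Finset.sum_congr rfl fun e _ => Finset.sum_comm]
        rw [Finset.sum_comm]
        refine Finset.sum_congr rfl fun c' _ => ?_
        refine Finset.sum_congr rfl fun e _ => Finset.sum_congr rfl fun t _ => ?_
        ring
    _ = ∑ c ∈ s, (p c : ℂ) := by
        refine Finset.sum_congr rfl fun c hc => ?_
        simp only [hH, mul_ite, mul_zero]
        rw [Finset.sum_ite_eq, if_pos hc, bitSign_mul_self, one_mul]

/-! ### Cosets of a linear code -/

section Code

variable {n : ℕ}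

/-- Prescribed values on a basis of the span define a functional, which extends to the whole space
and is the dot product with its values on the standard basis. -/
lemma exists_forall_dotProduct_eq {α : Type*} {v : α → Fin n → ZMod 2}
    (hv : LinearIndependent (ZMod 2) v) (g : α → ZMod 2) : ∃ x : Fin n → ZMod 2, ∀ a, x ⬝ᵥ v a = g a := by
  let B := Module.Basis.span hv
  obtain ⟨f, hf⟩ := LinearMap.exists_extend (B.constr (ZMod 2) g)
  refine ⟨fun i => f (Pi.single i 1), fun a => ?_⟩
  have h1 : f (v a) = g a := by
    have h2 := LinearMap.congr_fun hf (B a)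
    rw [Module.Basis.constr_basis] at h2
    rw [← h2]
    simp [B, Module.Basis.span_apply]
  rw [← h1, dotProduct]
  conv_rhs => rw [pi_eq_sum_univ' (v a), map_sum]
  refine Finset.sum_congr rfl fun i _ => ?_
  rw [map_smul, smul_eq_mul, mul_comm]

/-- The strings with the values `g` of the parities given by `v`. -/
def parityCoset {q : ℕ} (v : Fin q → Fin n → ZMod 2) (g : Fin q → ZMod 2) :
    Finset (Fin n → ZMod 2) :=
  Finset.univ.filter fun x => ∀ a, x ⬝ᵥ v a = g a

/-- Translation by `x₀` carries one coset onto the other, since `g + g' = g - g'` in characteristic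
two. -/
lemma sum_parityCoset_eq_of_shift {q : ℕ} {v : Fin q → Fin n → ZMod 2} {g g' : Fin q → ZMod 2}
    {M : Type*} [AddCommMonoid M] {f : (Fin n → ZMod 2) → M} {x₀ : Fin n → ZMod 2}
    (hx₀ : ∀ a, x₀ ⬝ᵥ v a = g a + g' a) (hf : ∀ x, f (x + x₀) = f x) :
    ∑ x ∈ parityCoset v g, f x = ∑ x ∈ parityCoset v g', f x := by
  refine Finset.sum_equiv (Equiv.addRight x₀) (fun x => ?_) fun x _ => ?_
  · simp only [parityCoset, Finset.mem_filter, Finset.mem_univ, true_and, Equiv.coe_addRight,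
      add_dotProduct, hx₀]
    refine forall_congr' fun a => ?_
    rw [← add_assoc, add_eq_right]
    rw [← CharTwo.sub_eq_add, sub_eq_zero]
  · simp [hf]

lemma card_parityCoset {q : ℕ} {v : Fin q → Fin n → ZMod 2} (hv : LinearIndependent (ZMod 2) v)
    (g : Fin q → ZMod 2) : (parityCoset v g).card = 2 ^ (n - q) := by
  have hq : q ≤ n := by
    have := hv.fintype_card_le_finrank
    simpa using this
  have hcard : ∀ g', (parityCoset v g').card = (parityCoset v g).card := by
    intro g'
    obtain ⟨x₀, hx₀⟩ := exists_forall_dotProduct_eq hv (g' + g)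
    rw [Finset.card_eq_sum_ones, Finset.card_eq_sum_ones]
    exact sum_parityCoset_eq_of_shift hx₀ fun _ => rfl
  have hsum : ∑ g' : Fin q → ZMod 2, (parityCoset v g').card = 2 ^ n := by
    have h1 := Finset.card_eq_sum_card_fiberwise (s := (Finset.univ : Finset (Fin n → ZMod 2)))
      (t := Finset.univ) (f := fun x a => x ⬝ᵥ v a) (by simp)
    rw [Finset.card_univ, Fintype.card_fun, ZMod.card, Fintype.card_fin] at h1
    rw [h1]
    refine Finset.sum_congr rfl fun g' _ => ?_
    simp only [parityCoset, funext_iff]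
  simp only [hcard, Finset.sum_const, Finset.card_univ, Fintype.card_fun, ZMod.card,
    Fintype.card_fin, smul_eq_mul] at hsum
  have h2 : 2 ^ n = 2 ^ q * 2 ^ (n - q) := by rw [← pow_add]; congr 1; omega
  rw [h2] at hsum
  exact Nat.eq_of_mul_eq_mul_left (by positivity) hsum

variable {r m : ℕ} {v : Fin (r + m) → Fin n → ZMod 2}

/-- Let `j` be the largest index with nonzero coefficient in `u`. Outside the span of the first `r`
vectors `j ≥ r`, and `u` is `v j` minus a combination `w` of earlier vectors, so its weight is a
distance occurring in the minimum. -/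
lemma keyDist_le_hammingNorm {u : Fin n → ZMod 2}
    (hu : u ∈ Submodule.span (ZMod 2) (Set.range v))
    (hu' : u ∉ Submodule.span (ZMod 2) (Set.range fun a => v (Fin.castAdd m a))) :
    keyDist r m v ≤ hammingNorm u := by
  obtain ⟨a, rfl⟩ := (Submodule.mem_span_range_iff_exists_fun (ZMod 2)).1 hu
  set s := Finset.univ.filter fun i => a i ≠ 0 with hs
  have hmem : ∀ i, ∀ w : Submodule (ZMod 2) (Fin n → ZMod 2), (a i ≠ 0 → v i ∈ w) → a i • v i ∈ w := by
    intro i w h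
    by_cases h0 : a i = 0
    · simp [h0]
    · exact w.smul_mem _ (h h0)
  have hne : s.Nonempty := by
    by_contra h
    rw [Finset.not_nonempty_iff_eq_empty, Finset.filter_eq_empty_iff] at h
    refine hu' (Submodule.sum_mem _ fun i _ => hmem i _ fun h0 => absurd h0 ?_)
    exact h (Finset.mem_univ i)
  set j := s.max' hne with hj
  have hja : a j ≠ 0 := (Finset.mem_filter.1 (s.max'_mem hne)).2
  have hle : ∀ i, a i ≠ 0 → i ≤ j := fun i hi => s.le_max' i (by simp [hs, hi])
  have hjr : r ≤ (j : ℕ) := by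
    by_contra h
    refine hu' (Submodule.sum_mem _ fun i _ => hmem i _ fun h0 => Submodule.subset_span ?_)
    have : (i : ℕ) < r := lt_of_le_of_lt (hle i h0) (by omega)
    exact ⟨⟨i, this⟩, rfl⟩
  obtain ⟨j', hj'⟩ : ∃ j' : Fin m, j = Fin.natAdd r j' :=
    ⟨⟨j - r, by omega⟩, by ext; simp; omega⟩
  have ha1 : a j = 1 := (zmod_two_cases (a j)).resolve_left hja
  set w := v j - ∑ i, a i • v i with hw
  have hwmem : w ∈ Submodule.span (ZMod 2) (v '' {i | i < Fin.natAdd r j'}) := by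
    rw [hw, ← Finset.add_sum_erase _ _ (Finset.mem_univ j), ha1, one_smul, sub_add_cancel_left]
    refine Submodule.neg_mem _ (Submodule.sum_mem _ fun i hi => hmem i _ fun h0 =>
      Submodule.subset_span ⟨i, ?_, rfl⟩)
    rw [← hj']
    exact lt_of_le_of_ne (hle i h0) (Finset.ne_of_mem_erase hi)
  have hdist : hammingDist (v (Fin.natAdd r j')) w = hammingNorm (∑ i, a i • v i) := by
    rw [← hj', hammingDist_eq_hammingNorm, hw, sub_eq_add_neg, neg_add_cancel_left]
    congr 1
    exact funext fun i => CharTwo.neg_eq _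
  rw [← hdist]
  exact iInf_le_of_le j' (iInf₂_le w hwmem)

/-- The characters of small weight do not distinguish the keys. -/
lemma sum_parityCoset_bitSign_eq (hv : LinearIndependent (ZMod 2) v) {u : Fin n → ZMod 2}
    (hu : (hammingNorm u : ℕ∞) < keyDist r m v) (ξ : Fin r → ZMod 2) (k k' : Fin m → ZMod 2) :
    ∑ x ∈ parityCoset v (Fin.append ξ k), bitSign (u ⬝ᵥ x) =
      ∑ x ∈ parityCoset v (Fin.append ξ k'), bitSign (u ⬝ᵥ x) := by
  set g := Fin.append ξ k
  set g' := Fin.append ξ k'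
  -- The translation between the two cosets must also preserve the character, i.e. `u ⬝ᵥ x₀ = 0`. If
  -- `u` lies in the span of `v`, its small weight puts it in the span of the parity rows, where
  -- `x₀` vanishes because both cosets share `ξ`. Otherwise `u` is independent of `v` and the
  -- condition can be imposed.
  obtain ⟨x₀, hx₀, hux₀⟩ : ∃ x₀ : Fin n → ZMod 2, (∀ a, x₀ ⬝ᵥ v a = g a + g' a) ∧ u ⬝ᵥ x₀ = 0 := by
    by_cases h : u ∈ Submodule.span (ZMod 2) (Set.range v)
    · have h' : u ∈ Submodule.span (ZMod 2) (Set.range fun a => v (Fin.castAdd m a)) := by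
        by_contra h'
        exact absurd (keyDist_le_hammingNorm h h') (not_le.2 hu)
      obtain ⟨x₀, hx₀⟩ := exists_forall_dotProduct_eq hv (g + g')
      refine ⟨x₀, hx₀, ?_⟩
      clear hu h
      induction h' using Submodule.span_induction with
      | mem y hy =>
        obtain ⟨a, rfl⟩ := hy
        rw [dotProduct_comm]
        simp only [hx₀, Pi.add_apply]
        simp only [g, g', Fin.append_left, zmod_two_add_self]
      | zero => simp
      | add y z _ _ hy hz => rw [add_dotProduct, hy, hz, add_zero]
      | smul c y _ hy => rw [smul_dotProduct, hy, smul_zero]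
    · have hcons : LinearIndependent (ZMod 2) (Fin.cons u v : Fin (r + m + 1) → Fin n → ZMod 2) :=
        linearIndependent_finCons.2 ⟨hv, h⟩
      obtain ⟨x₀, hx₀⟩ := exists_forall_dotProduct_eq hcons (Fin.cons 0 (g + g'))
      refine ⟨x₀, fun a => ?_, ?_⟩
      · simpa using hx₀ a.succ
      · rw [dotProduct_comm]
        simpa using hx₀ 0
  exact sum_parityCoset_eq_of_shift hx₀ fun x => by rw [dotProduct_add, hux₀, add_zero]

end Code

/-! ### The trace distance between the states for two keys -/

lemma hammingNorm_add_le {J : Type*} [Fintype J] (c c' : J → ZMod 2) :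
    hammingNorm (c + c') ≤ hammingNorm c + hammingNorm c' := by
  have h := hammingDist_triangle c 0 (-c')
  rw [hammingDist_zero_right, hammingDist_comm 0, hammingDist_zero_right] at h
  have e : -c' = c' := funext fun i => CharTwo.neg_eq _
  rw [hammingDist_eq_hammingNorm, e] at h
  have e' : -c = c := funext fun i => CharTwo.neg_eq _
  rwa [e'] at h

lemma partialTrace_sum_modes {α κ τ : Type*} [Fintype τ] (s : Finset α) (a : α → ℂ)
    (H : α → κ → τ → ℂ) :
    partialTrace (fun e t => ∑ c ∈ s, a c * H c e t) (fun e t => ∑ c ∈ s, a c * H c e t) =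
      ∑ c ∈ s, ∑ c' ∈ s, (a c * star (a c')) • partialTrace (H c) (H c') := by
  ext e e'
  simp only [partialTrace, Matrix.of_apply, Matrix.sum_apply, Matrix.smul_apply, smul_eq_mul,
    star_sum, star_mul', Finset.sum_mul_sum]
  simp only [Finset.mul_sum]
  rw [Finset.sum_comm]
  refine Finset.sum_congr rfl fun c _ => ?_
  rw [Finset.sum_comm]
  refine Finset.sum_congr rfl fun c' _ => Finset.sum_congr rfl fun t _ => ?_
  ring

section KeyStates

variable {n r m : ℕ} {ι : Fin n → Type*} [∀ j, Fintype (ι j)] [∀ j, DecidableEq (ι j)]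

/-- The states of the probes for two keys are close if errors of weight more than `t` in
the `x` basis are unlikely, where the characters of weight at most `2 t` do not distinguish keys. -/
lemma traceNorm_sub_le_of_keyDist {v : Fin (r + m) → Fin n → ZMod 2}
    (hv : LinearIndependent (ZMod 2) v) (A : ∀ j, QubitAttack (ι j)) {t : ℝ}
    (ht : ∀ u : Fin n → ZMod 2, (hammingNorm u : ℝ) ≤ 2 * t →
      (hammingNorm u : ℕ∞) < keyDist r m v)
    (ξ : Fin r → ZMod 2) (k k' : Fin m → ZMod 2) :
    traceNorm (((2 : ℂ) ^ (n - (r + m)))⁻¹ •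
        ∑ x ∈ parityCoset v (Fin.append ξ k), eveState A 0 x -
      ((2 : ℂ) ^ (n - (r + m)))⁻¹ •
        ∑ x ∈ parityCoset v (Fin.append ξ k'), eveState A 0 x) ≤
      4 * Real.sqrt (∑ c with t < (hammingNorm c : ℝ), ∏ j, (A j).flipProb 1 (c j)) := by
  obtain ⟨H, hH, hH'⟩ := exists_joint_orthogonal_modes A
  set p : (Fin n → ZMod 2) → ℝ := fun c => ∏ j, (A j).flipProb 1 (c j) with hp
  have hp0 : ∀ c, 0 ≤ p c := fun c => Finset.prod_nonneg fun j _ => (A j).flipProb_nonneg _ _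
  have hp1 : ∑ c, p c = 1 := by
    have := Finset.prod_univ_sum (fun _ : Fin n => (Finset.univ : Finset (ZMod 2)))
      fun j c => (A j).flipProb 1 c
    rw [Fintype.piFinset_univ] at this
    rw [hp, ← this]
    simp [QubitAttack.sum_flipProb]
  set hi : Finset (Fin n → ZMod 2) := Finset.univ.filter fun c => t < (hammingNorm c : ℝ) with hhi
  set lo : Finset (Fin n → ZMod 2) := Finset.univ.filter fun c => ¬ t < (hammingNorm c : ℝ) with hlo
  set q : ℝ := ∑ c ∈ hi, p c with hq
  set Φ : Finset (Fin n → ZMod 2) → (Fin n → ZMod 2) → (∀ j, ι j) → (Fin n → ZMod 2 × Bool) → ℂ :=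
    fun s x e κ => ∑ c ∈ s, bitSign (c ⬝ᵥ x) * H c e κ with hΦ
  have hΦnorm : ∀ s x, ∑ e, ∑ κ, ‖Φ s x e κ‖ ^ 2 = ∑ c ∈ s, p c := fun s x =>
    sum_norm_sq_sum_modes hH' s x
  have hΦsub : ∀ x, Φ Finset.univ x - Φ lo x = Φ hi x := by
    intro x
    ext e κ
    simp only [hΦ, Pi.sub_apply, hlo, hhi]
    rw [sub_eq_iff_eq_add]
    exact (Finset.sum_filter_add_sum_filter_not _ _ _).symm
  have hle1 : ∀ s : Finset (Fin n → ZMod 2), Real.sqrt (∑ c ∈ s, p c) ≤ 1 := by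
    intro s
    refine Real.sqrt_le_one.2 ?_
    rw [← hp1]
    exact Finset.sum_le_sum_of_subset_of_nonneg (Finset.subset_univ s) fun c _ _ => hp0 c
  set N : ℂ := (2 : ℂ) ^ (n - (r + m)) with hN
  -- A single `W` for the difference of the two key states makes its trace norm linear in the
  -- states, so that they can be truncated inside the trace.
  obtain ⟨W, hW, htr⟩ := exists_traceNorm_eq_trace_mul
    (N⁻¹ • ∑ x ∈ parityCoset v (Fin.append ξ k), eveState A 0 x -
      N⁻¹ • ∑ x ∈ parityCoset v (Fin.append ξ k'), eveState A 0 x)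
  set L : Finset (Fin n → ZMod 2) → (Fin n → ZMod 2) → ℂ :=
    fun s x => (W * partialTrace (Φ s x) (Φ s x)).trace with hL
  -- From `|a⟩⟨a| - |b⟩⟨b| = |a - b⟩⟨a| + |b⟩⟨a - b|`, with `‖a - b‖² = q` and `‖a‖, ‖b‖ ≤ 1`.
  have hLdiff : ∀ x, ‖L Finset.univ x - L lo x‖ ≤ 2 * Real.sqrt q := by
    intro x
    have h1 : L Finset.univ x - L lo x =
        (W * partialTrace (Φ hi x) (Φ Finset.univ x)).trace +
          (W * partialTrace (Φ lo x) (Φ hi x)).trace := by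
      rw [← hΦsub, partialTrace_sub_left, partialTrace_sub_right, Matrix.mul_sub, Matrix.mul_sub,
        Matrix.trace_sub, Matrix.trace_sub]
      simp only [hL]
      ring
    rw [h1]
    refine (norm_add_le _ _).trans ?_
    have h2 := norm_trace_mul_partialTrace_le hW (Φ hi x) (Φ Finset.univ x)
    have h3 := norm_trace_mul_partialTrace_le hW (Φ lo x) (Φ hi x)
    rw [hΦnorm, hΦnorm] at h2 h3
    have h4 := mul_le_mul_of_nonneg_left (hle1 Finset.univ) (Real.sqrt_nonneg q)
    have h5 := mul_le_mul_of_nonneg_right (hle1 lo) (Real.sqrt_nonneg q)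
    rw [mul_one] at h4
    rw [one_mul] at h5
    linarith
  -- Expanding the truncated state gives characters of `c + c'`, of weight at most `2 t`, whose sums
  -- over the two cosets agree.
  have hLlo : ∑ x ∈ parityCoset v (Fin.append ξ k), L lo x =
      ∑ x ∈ parityCoset v (Fin.append ξ k'), L lo x := by
    have hexp : ∀ x, L lo x = ∑ c ∈ lo, ∑ c' ∈ lo,
        bitSign ((c + c') ⬝ᵥ x) * (W * partialTrace (H c) (H c')).trace := by
      intro x
      simp only [hL, hΦ]
      rw [partialTrace_sum_modes]
      simp only [Matrix.mul_sum, Matrix.trace_sum, Matrix.mul_smul, Matrix.trace_smul, smul_eq_mul,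
        star_bitSign, ← bitSign_add, ← add_dotProduct]
    simp only [hexp]
    rw [Finset.sum_comm, Finset.sum_comm (s := parityCoset v (Fin.append ξ k'))]
    refine Finset.sum_congr rfl fun c hc => ?_
    rw [Finset.sum_comm, Finset.sum_comm (s := parityCoset v (Fin.append ξ k'))]
    refine Finset.sum_congr rfl fun c' hc' => ?_
    rw [← Finset.sum_mul, ← Finset.sum_mul]
    congr 1
    refine sum_parityCoset_bitSign_eq hv (ht _ ?_) ξ k k'
    have h1 : (hammingNorm c : ℝ) ≤ t := not_lt.1 (Finset.mem_filter.1 hc).2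
    have h2 : (hammingNorm c' : ℝ) ≤ t := not_lt.1 (Finset.mem_filter.1 hc').2
    have h3 : (hammingNorm (c + c') : ℝ) ≤ hammingNorm c + hammingNorm c' := by
      exact_mod_cast hammingNorm_add_le c c'
    linarith
  have htr' : ∀ g, (W * (N⁻¹ • ∑ x ∈ parityCoset v g, eveState A 0 x)).trace =
      N⁻¹ * ∑ x ∈ parityCoset v g, L Finset.univ x := by
    intro g
    rw [Matrix.mul_smul, Matrix.trace_smul, smul_eq_mul, Matrix.mul_sum, Matrix.trace_sum]
    simp only [hL, hΦ, hH]
  rw [Matrix.mul_sub, Matrix.trace_sub, htr', htr'] at htr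
  have hbound : ∀ g, ‖N⁻¹ * ∑ x ∈ parityCoset v g, (L Finset.univ x - L lo x)‖ ≤
      2 * Real.sqrt q := by
    intro g
    have h1 : ‖∑ x ∈ parityCoset v g, (L Finset.univ x - L lo x)‖ ≤
        (parityCoset v g).card • (2 * Real.sqrt q) :=
      norm_sum_le_of_le _ (fun x _ => hLdiff x) |>.trans (by rw [Finset.sum_const])
    rw [card_parityCoset hv, nsmul_eq_mul] at h1
    have h2 : ‖N⁻¹‖ = ((2 : ℝ) ^ (n - (r + m)))⁻¹ := by
      rw [hN, norm_inv, norm_pow, Complex.norm_ofNat]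
    rw [norm_mul, h2, inv_mul_le_iff₀ (by positivity)]
    exact_mod_cast h1
  have hfin : (traceNorm (N⁻¹ • ∑ x ∈ parityCoset v (Fin.append ξ k), eveState A 0 x -
      N⁻¹ • ∑ x ∈ parityCoset v (Fin.append ξ k'), eveState A 0 x) : ℂ) =
      N⁻¹ * ∑ x ∈ parityCoset v (Fin.append ξ k), (L Finset.univ x - L lo x) -
      N⁻¹ * ∑ x ∈ parityCoset v (Fin.append ξ k'), (L Finset.univ x - L lo x) := by
    rw [htr, Finset.sum_sub_distrib, Finset.sum_sub_distrib, hLlo]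
    ring
  have hnorm := congrArg norm hfin
  rw [Complex.norm_real] at hnorm
  calc _ ≤ _ := Real.le_norm_self _
    _ = _ := hnorm
    _ ≤ _ := norm_sub_le _ _
    _ ≤ 2 * Real.sqrt q + 2 * Real.sqrt q := add_le_add (hbound _) (hbound _)
    _ = _ := by ring

end KeyStates

/-! ### Partitions -/

section Partition

variable {n nz nx : ℕ}

lemma mem_range_positions {N k : ℕ} (s : Fin N → ZMod 2) (h : hammingNorm s = k) (j : Fin N) :
    j ∈ Set.range (positions s h) ↔ s j ≠ 0 := by
  have h1 := Finset.range_orderEmbOfFin (Finset.univ.filter fun j => s j ≠ 0) h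
  refine (Set.ext_iff.1 h1 j).trans ?_
  rw [Finset.mem_coe, Finset.mem_filter]
  exact and_iff_right (Finset.mem_univ j)

lemma positions_injective {N k : ℕ} (s : Fin N → ZMod 2) (h : hammingNorm s = k) :
    Function.Injective (positions s h) :=
  (Finset.orderEmbOfFin _ h).injective

lemma hammingNorm_comp_positions {N k : ℕ} (s : Fin N → ZMod 2) (h : hammingNorm s = k)
    (c : Fin N → ZMod 2) :
    hammingNorm (c ∘ positions s h) =
      (Finset.univ.filter fun j => s j ≠ 0 ∧ c j ≠ 0).card := by
  rw [hammingNorm, ← Finset.card_map ⟨positions s h, positions_injective s h⟩]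
  congr 1
  ext j
  simp only [Finset.mem_map, Finset.mem_filter, Finset.mem_univ, true_and, Function.comp_apply,
    Function.Embedding.coeFn_mk, ← mem_range_positions s h j]
  constructor
  · rintro ⟨a, ha, rfl⟩
    exact ⟨⟨a, rfl⟩, ha⟩
  · rintro ⟨⟨a, rfl⟩, ha⟩
    exact ⟨a, ha, rfl⟩

/-- The INFO, TEST-Z and TEST-X positions exhaust all positions, without repetitions. -/
lemma bijective_sumElim_positions (P : BitPartition n nz nx) :
    Function.Bijective (Sum.elim (infoPos P) (Sum.elim (testZPos P) (testXPos P))) := by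
  -- Full weight of `s + z + b` only says that every position is covered; since the three weights
  -- add up to the number of positions, overlaps are excluded by counting.
  rw [Fintype.bijective_iff_surjective_and_card]
  refine ⟨fun j => ?_, by simp [add_assoc]⟩
  have hj : (P.1.1 + P.1.2.1 + P.1.2.2) j ≠ 0 := by
    have h := P.2.2.2.2
    have h1 : (Finset.univ.filter fun j => (P.1.1 + P.1.2.1 + P.1.2.2) j ≠ 0) = Finset.univ := by
      rw [← Finset.card_eq_iff_eq_univ, Fintype.card_fin]
      exact h
    have h2 := Finset.mem_univ j
    rw [← h1] at h2
    exact (Finset.mem_filter.1 h2).2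
  by_cases hs : P.1.1 j = 0
  · by_cases hz : P.1.2.1 j = 0
    · have hb : P.1.2.2 j ≠ 0 := by simpa [hs, hz] using hj
      obtain ⟨a, ha⟩ := (mem_range_positions _ P.2.2.2.1 j).2 hb
      exact ⟨Sum.inr (Sum.inr a), ha⟩
    · obtain ⟨a, ha⟩ := (mem_range_positions _ P.2.2.1 j).2 hz
      exact ⟨Sum.inr (Sum.inl a), ha⟩
  · obtain ⟨a, ha⟩ := (mem_range_positions _ P.2.1 j).2 hs
    exact ⟨Sum.inl a, ha⟩

lemma BitPartition.testZ_eq_zero (P : BitPartition n nz nx) {j : Fin (n + nz + nx)}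
    (h : P.1.1 j ≠ 0) : P.1.2.1 j = 0 := by
  by_contra hz
  obtain ⟨a, ha⟩ := (mem_range_positions _ P.2.1 j).2 h
  obtain ⟨a', ha'⟩ := (mem_range_positions _ P.2.2.1 j).2 hz
  have := @(bijective_sumElim_positions P).1 (Sum.inl a) (Sum.inr (Sum.inl a')) (ha.trans ha'.symm)
  simp at this

lemma BitPartition.testX_ne_zero_iff (P : BitPartition n nz nx) (j : Fin (n + nz + nx)) :
    P.1.2.2 j ≠ 0 ↔ P.1.1 j = 0 ∧ P.1.2.1 j = 0 := by
  constructor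
  · intro hb
    obtain ⟨a, ha⟩ := (mem_range_positions _ P.2.2.2.1 j).2 hb
    constructor
    · by_contra hs
      obtain ⟨a', ha'⟩ := (mem_range_positions _ P.2.1 j).2 hs
      have := @(bijective_sumElim_positions P).1 (Sum.inr (Sum.inr a)) (Sum.inl a')
        (ha.trans ha'.symm)
      simp at this
    · by_contra hz
      obtain ⟨a', ha'⟩ := (mem_range_positions _ P.2.2.1 j).2 hz
      have := @(bijective_sumElim_positions P).1 (Sum.inr (Sum.inr a)) (Sum.inr (Sum.inl a'))
        (ha.trans ha'.symm)
      simp at this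
  · rintro ⟨hs, hz⟩
    obtain ⟨x, hx⟩ := (bijective_sumElim_positions P).2 j
    rcases x with a | a | a
    · exact absurd hs ((mem_range_positions _ P.2.1 j).1 ⟨a, hx⟩)
    · exact absurd hz ((mem_range_positions _ P.2.2.1 j).1 ⟨a, hx⟩)
    · exact (mem_range_positions _ P.2.2.2.1 j).1 ⟨a, hx⟩

lemma BitPartition.testX_comp_infoPos (P : BitPartition n nz nx) : P.1.2.2 ∘ infoPos P = 0 := by
  funext a
  by_contra h
  exact (mem_range_positions _ P.2.1 _).1 ⟨a, rfl⟩ ((P.testX_ne_zero_iff _).1 h).1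

lemma BitPartition.testX_testXPos (P : BitPartition n nz nx) (a : Fin nx) :
    P.1.2.2 (testXPos P a) = 1 :=
  (zmod_two_cases _).resolve_left ((mem_range_positions _ P.2.2.2.1 _).1 ⟨a, rfl⟩)

lemma BitPartition.card_filter_testZ_eq_zero (P : BitPartition n nz nx) :
    (Finset.univ.filter fun j => P.1.2.1 j = 0).card = n + nx := by
  have h1 : (Finset.univ.filter fun j => P.1.2.1 j = 0) =
      (Finset.univ.filter fun j => P.1.2.1 j ≠ 0)ᶜ := by
    ext j
    simp
  have h2 : (Finset.univ.filter fun j => P.1.2.1 j ≠ 0).card = nz := P.2.2.1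
  rw [h1, Finset.card_compl, h2, Fintype.card_fin]
  omega

/-- The partitions with given TEST-Z positions correspond to the sets of INFO positions. -/
lemma card_filter_testZ_eq (P₀ : BitPartition n nz nx)
    (p : Finset (Fin (n + nz + nx)) → Prop) [DecidablePred p] :
    (Finset.univ.filter fun P : BitPartition n nz nx => P.1.2.1 = P₀.1.2.1 ∧
        p (Finset.univ.filter fun j => P.1.1 j ≠ 0)).card =
      ((Finset.powersetCard n (Finset.univ.filter fun j => P₀.1.2.1 j = 0)).filter p).card := by
  set Q := Finset.univ.filter fun j => P₀.1.2.1 j = 0 with hQ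
  have hQcard : Q.card = n + nx := P₀.card_filter_testZ_eq_zero
  refine Finset.card_bij (fun P _ => Finset.univ.filter fun j => P.1.1 j ≠ 0) ?_ ?_ ?_
  · intro P hP
    obtain ⟨hz, hp⟩ := (Finset.mem_filter.1 hP).2
    refine Finset.mem_filter.2 ⟨Finset.mem_powersetCard.2 ⟨fun j hj => ?_, P.2.1⟩, hp⟩
    refine Finset.mem_filter.2 ⟨Finset.mem_univ j, ?_⟩
    rw [← hz]
    exact P.testZ_eq_zero (Finset.mem_filter.1 hj).2
  · intro P hP P' hP' hPP'
    have hz : P.1.2.1 = P'.1.2.1 :=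
      (Finset.mem_filter.1 hP).2.1.trans (Finset.mem_filter.1 hP').2.1.symm
    have hext : ∀ a b : ZMod 2, (a ≠ 0 ↔ b ≠ 0) → a = b := by decide
    have hs : P.1.1 = P'.1.1 := by
      funext j
      refine hext _ _ ?_
      have := Finset.ext_iff.1 hPP' j
      simpa using this
    have hb : P.1.2.2 = P'.1.2.2 := by
      funext j
      refine hext _ _ ?_
      rw [P.testX_ne_zero_iff, P'.testX_ne_zero_iff, hs, hz]
    exact Subtype.ext (Prod.ext hs (Prod.ext hz hb))
  · intro S hS
    obtain ⟨hS1, hp⟩ := Finset.mem_filter.1 hS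
    obtain ⟨hSQ, hSn⟩ := Finset.mem_powersetCard.1 hS1
    have hind : ∀ T : Finset (Fin (n + nz + nx)),
        (Finset.univ.filter fun j => (if j ∈ T then (1 : ZMod 2) else 0) ≠ 0) = T := by
      intro T
      ext j
      simp
    refine ⟨⟨(fun j => if j ∈ S then 1 else 0, P₀.1.2.1, fun j => if j ∈ Q \ S then 1 else 0),
      ?_, P₀.2.2.1, ?_, ?_⟩, ?_, ?_⟩
    · rw [hammingNorm]
      dsimp only
      rw [hind, hSn]
    · rw [hammingNorm]
      dsimp only
      rw [hind, Finset.card_sdiff_of_subset hSQ, hQcard, hSn]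
      omega
    · rw [hammingNorm]
      have : (Finset.univ.filter fun j => ((fun j => if j ∈ S then (1 : ZMod 2) else 0) +
          P₀.1.2.1 + (fun j => if j ∈ Q \ S then 1 else 0) : Fin (n + nz + nx) → ZMod 2) j ≠ 0) = Finset.univ := by
        refine Finset.filter_true_of_mem fun j _ => ?_
        simp only [Pi.add_apply]
        by_cases hjS : j ∈ S
        · have hz : P₀.1.2.1 j = 0 := (Finset.mem_filter.1 (hSQ hjS)).2
          simp [hjS, hz]
        · by_cases hz : P₀.1.2.1 j = 0
          · have : j ∈ Q := Finset.mem_filter.2 ⟨Finset.mem_univ j, hz⟩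
            simp [hjS, hz, this]
          · have : j ∉ Q := fun h => hz (Finset.mem_filter.1 h).2
            simp [hjS, this, hz]
      dsimp only
      rw [this, Finset.card_univ, Fintype.card_fin]
    · refine Finset.mem_filter.2 ⟨Finset.mem_univ _, rfl, ?_⟩
      dsimp only
      rw [hind]
      exact hp
    · dsimp only
      rw [hind]

/-- For a fixed error string, few partitions show an error rate on the INFO bits that exceeds
the one on the TEST-X bits by `ε`. -/
lemma card_filter_errorRate_le (hn : 0 < n) (hnx : 0 < nx) {ε : ℝ} (hε : 0 ≤ ε)
    (c : Fin (n + nz + nx) → ZMod 2) :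
    ((Finset.univ.filter fun P : BitPartition n nz nx =>
        ε ≤ (hammingNorm (c ∘ infoPos P) : ℝ) / n - (hammingNorm (c ∘ testXPos P) : ℝ) / nx).card : ℝ) ≤
      Fintype.card (BitPartition n nz nx) *
        Real.exp (-(2 * (((nx : ℝ) / ((n : ℝ) + (nx : ℝ))) ^ 2 * n * ε ^ 2))) := by
  set E := Real.exp (-(2 * (((nx : ℝ) / ((n : ℝ) + (nx : ℝ))) ^ 2 * n * ε ^ 2))) with hE
  set bad : BitPartition n nz nx → Prop := fun P =>
    ε ≤ (hammingNorm (c ∘ infoPos P) : ℝ) / n - (hammingNorm (c ∘ testXPos P) : ℝ) / nx with hbad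
  -- Conditioning on TEST-Z: the INFO set is then a uniform `n`-subset of the remaining `n + nx`
  -- positions, with TEST-X as its complement, so Hoeffding's bound applies in each fibre.
  have h1 := Finset.card_eq_sum_card_fiberwise (s := Finset.univ.filter bad) (t := Finset.univ)
    (f := fun P : BitPartition n nz nx => P.1.2.1) (by simp)
  have h2 := Finset.card_eq_sum_card_fiberwise
    (s := (Finset.univ : Finset (BitPartition n nz nx))) (t := Finset.univ)
    (f := fun P : BitPartition n nz nx => P.1.2.1) (by simp)
  rw [h1, ← Finset.card_univ, h2]
  push_cast
  rw [Finset.sum_mul]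
  refine Finset.sum_le_sum fun z _ => ?_
  rw [Finset.filter_filter]
  by_cases hz : ∃ P₀ : BitPartition n nz nx, P₀.1.2.1 = z
  · obtain ⟨P₀, rfl⟩ := hz
    set Q := Finset.univ.filter fun j => P₀.1.2.1 j = 0 with hQ
    set K := Q.filter fun j => c j ≠ 0 with hK
    have hQcard : Q.card = n + nx := P₀.card_filter_testZ_eq_zero
    have hbound := card_filter_powersetCard_le (Finset.filter_subset (fun j => c j ≠ 0) Q) hn hnx
      hQcard hε
    have e1 := card_filter_testZ_eq P₀ fun S =>
      ε ≤ ((S ∩ K).card : ℝ) / n - ((K \ S).card : ℝ) / nx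
    have e2 := card_filter_testZ_eq P₀ fun _ => True
    simp only [and_true, Finset.filter_true] at e2
    rw [← hQ] at e1 e2
    rw [← hK, ← e1, ← e2] at hbound
    refine le_trans (le_of_eq ?_) hbound
    congr 2
    ext P
    simp only [Finset.mem_filter, Finset.mem_univ, true_and, hbad]
    rw [and_comm]
    refine and_congr_right fun hz => ?_
    have i1 : hammingNorm (c ∘ infoPos P) =
        ((Finset.univ.filter fun j => P.1.1 j ≠ 0) ∩ K).card := by
      rw [infoPos, hammingNorm_comp_positions]
      congr 1
      ext j
      simp only [hK, hQ, Finset.mem_filter, Finset.mem_univ, true_and, Finset.mem_inter, ← hz]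
      exact ⟨fun h => ⟨h.1, P.testZ_eq_zero h.1, h.2⟩, fun h => ⟨h.1, h.2.2⟩⟩
    have i2 : hammingNorm (c ∘ testXPos P) =
        (K \ (Finset.univ.filter fun j => P.1.1 j ≠ 0)).card := by
      rw [testXPos, hammingNorm_comp_positions]
      congr 1
      ext j
      simp only [hK, hQ, Finset.mem_filter, Finset.mem_univ, true_and, Finset.mem_sdiff, ← hz,
        P.testX_ne_zero_iff, not_not]
      tauto
    rw [i1, i2]
  · have : (Finset.univ.filter fun P : BitPartition n nz nx => bad P ∧ P.1.2.1 = z) = ∅ :=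
      Finset.filter_eq_empty_iff.2 fun P _ h => hz ⟨P, h.2⟩
    rw [this]
    simp only [Finset.card_empty, Nat.cast_zero]
    positivity

end Partition

/-! ### The distribution of the errors -/

lemma outcomeProb_eq_prod {J : Type*} [Fintype J] [DecidableEq J] {ι : J → Type*}
    [∀ j, Fintype (ι j)] [∀ j, DecidableEq (ι j)] (A : ∀ j, QubitAttack (ι j))
    (b i iB : J → ZMod 2) :
    outcomeProb A b i iB = ∏ j, (A j).bitProb (b j) (i j) (iB j) := by
  simp only [QubitAttack.bitProb]
  rw [outcomeProb, Finset.prod_univ_sum, Fintype.piFinset_univ]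
  refine Finset.sum_congr rfl fun e _ => ?_
  rw [Finset.prod_pow, ← norm_prod, Finset.prod_univ_sum, Fintype.piFinset_univ]
  simp only [star_prod, jointState, ← Finset.prod_mul_distrib]

lemma sum_prod_eq_one {J : Type*} [Fintype J] [DecidableEq J] {w : J → ZMod 2 → ℝ}
    (hw : ∀ j, ∑ c, w j c = 1) :
    ∑ c : J → ZMod 2, ∏ j, w j (c j) = 1 := by
  have h := Finset.prod_univ_sum (fun _ : J => (Finset.univ : Finset (ZMod 2))) w
  rw [Fintype.piFinset_univ] at h
  rw [← h]
  simp [hw]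

/-- Independence of the bits at disjoint positions. -/
lemma sum_mul_mul_prod_eq {α β γ J : Type*} [Fintype α] [Fintype β] [Fintype γ] [Fintype J]
    [DecidableEq α] [DecidableEq β] [DecidableEq γ] [DecidableEq J]
    {I : α → J} {Z : β → J} {X : γ → J} (hb : Function.Bijective (Sum.elim I (Sum.elim Z X)))
    {w : J → ZMod 2 → ℝ} (hw : ∀ j, ∑ c, w j c = 1) (F : (α → ZMod 2) → ℝ)
    (G : (γ → ZMod 2) → ℝ) :
    ∑ c : J → ZMod 2, F (c ∘ I) * G (c ∘ X) * ∏ j, w j (c j) =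
      (∑ d, F d * ∏ a, w (I a) (d a)) * ∑ d, G d * ∏ a, w (X a) (d a) := by
  let E := Equiv.ofBijective _ hb
  let e : (J → ZMod 2) ≃ (α → ZMod 2) × (β → ZMod 2) × (γ → ZMod 2) :=
    (E.arrowCongr (Equiv.refl (ZMod 2))).symm.trans
      ((Equiv.sumArrowEquivProdArrow α (β ⊕ γ) (ZMod 2)).trans
        ((Equiv.refl _).prodCongr (Equiv.sumArrowEquivProdArrow β γ (ZMod 2))))
  have he : ∀ c, e c = (c ∘ I, c ∘ Z, c ∘ X) := fun c => rfl
  have hprod : ∀ c : J → ZMod 2, ∏ j, w j (c j) =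
      (∏ a, w (I a) (c (I a))) * ((∏ a, w (Z a) (c (Z a))) * ∏ a, w (X a) (c (X a))) := by
    intro c
    rw [← Equiv.prod_comp E fun j => w j (c j), Fintype.prod_sum_type, Fintype.prod_sum_type]
    rfl
  calc ∑ c : J → ZMod 2, F (c ∘ I) * G (c ∘ X) * ∏ j, w j (c j)
      = ∑ d : (α → ZMod 2) × (β → ZMod 2) × (γ → ZMod 2),
          F d.1 * G d.2.2 * ((∏ a, w (I a) (d.1 a)) *
            ((∏ a, w (Z a) (d.2.1 a)) * ∏ a, w (X a) (d.2.2 a))) := by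
        refine Fintype.sum_equiv e _ _ fun c => ?_
        rw [he, hprod]
        rfl
    _ = ∑ d₁ : α → ZMod 2, ∑ d₂ : β → ZMod 2, ∑ d₃ : γ → ZMod 2,
          (F d₁ * ∏ a, w (I a) (d₁ a)) * ((∏ a, w (Z a) (d₂ a)) *
            (G d₃ * ∏ a, w (X a) (d₃ a))) := by
        rw [Fintype.sum_prod_type]
        refine Finset.sum_congr rfl fun d₁ _ => ?_
        rw [Fintype.sum_prod_type]
        refine Finset.sum_congr rfl fun d₂ _ => Finset.sum_congr rfl fun d₃ _ => ?_
        ring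
    _ = _ := by
        simp only [← Finset.mul_sum, ← Finset.sum_mul]
        rw [sum_prod_eq_one fun a => hw (Z a), one_mul]

section Protocol

variable {n nz nx : ℕ} {ι : Fin (n + nz + nx) → Type*} [∀ j, Fintype (ι j)]
  [∀ j, DecidableEq (ι j)] {r m : ℕ}

lemma publicProb_nonneg (v : Fin (r + m) → Fin n → ZMod 2) (A : ∀ j, QubitAttack (ι j))
    (P : BitPartition n nz nx) (ξ : Fin r → ZMod 2) (cz : Fin nz → ZMod 2)
    (cb : Fin nx → ZMod 2) : 0 ≤ publicProb v A P ξ cz cb := by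
  refine Finset.sum_nonneg fun i _ => Finset.sum_nonneg fun iB _ => ?_
  split_ifs
  · rw [protocolProb, outcomeProb_eq_prod]
    exact mul_nonneg (by positivity) (Finset.prod_nonneg fun j _ => (A j).bitProb_nonneg _ _ _)
  · exact le_rfl

/-- The marginal distribution of the errors on the TEST-X bits. -/
lemma sum_mul_publicProb (v : Fin (r + m) → Fin n → ZMod 2) (A : ∀ j, QubitAttack (ι j))
    (P : BitPartition n nz nx) (h : (Fin nx → ZMod 2) → ℝ) :
    ∑ ξ, ∑ cz, ∑ cb, h cb * publicProb v A P ξ cz cb =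
      (Fintype.card (BitPartition n nz nx) : ℝ)⁻¹ *
        ∑ d, h d * ∏ a, (A (testXPos P a)).flipProb 1 (d a) := by
  have hswap : ∑ ξ, ∑ cz, ∑ cb, h cb * publicProb v A P ξ cz cb =
      ∑ i, ∑ iB, h ((i + iB) ∘ testXPos P) * protocolProb A P i iB := by
    simp only [publicProb, Finset.mul_sum]
    have hmove : ∀ (F : (Fin r → ZMod 2) → (Fin nz → ZMod 2) → (Fin nx → ZMod 2) →
        (Fin (n + nz + nx) → ZMod 2) → (Fin (n + nz + nx) → ZMod 2) → ℝ),
        ∑ ξ, ∑ cz, ∑ cb, ∑ i, ∑ iB, F ξ cz cb i iB =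
          ∑ i, ∑ iB, ∑ ξ, ∑ cz, ∑ cb, F ξ cz cb i iB := by
      intro F
      calc _ = ∑ t : (Fin r → ZMod 2) × (Fin nz → ZMod 2) × (Fin nx → ZMod 2),
            ∑ u : (Fin (n + nz + nx) → ZMod 2) × (Fin (n + nz + nx) → ZMod 2),
              F t.1 t.2.1 t.2.2 u.1 u.2 := by simp only [Fintype.sum_prod_type]
        _ = _ := by
          rw [Finset.sum_comm]
          simp only [Fintype.sum_prod_type]
    rw [hmove]
    refine Finset.sum_congr rfl fun i _ => Finset.sum_congr rfl fun iB _ => ?_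
    simp only [ite_and, mul_ite, mul_zero]
    simp only [Finset.sum_ite_irrel, Finset.sum_const_zero, Finset.sum_ite_eq, Finset.mem_univ,
      if_true]
  -- With `iB = i + c`, averaging over `i` turns every `bitProb` into a `flipProb`; the factor `2⁻ᴺ`
  -- supplies one `1 / 2` per position.
  have hshift : ∑ i, ∑ iB, h ((i + iB) ∘ testXPos P) * protocolProb A P i iB =
      (Fintype.card (BitPartition n nz nx) : ℝ)⁻¹ *
        ∑ c : Fin (n + nz + nx) → ZMod 2, h (c ∘ testXPos P) *
          ∏ j, (A j).flipProb (P.1.2.2 j) (c j) := by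
    have h1 : ∀ i : Fin (n + nz + nx) → ZMod 2,
        ∑ iB, h ((i + iB) ∘ testXPos P) * protocolProb A P i iB =
          ∑ c, h (c ∘ testXPos P) * protocolProb A P i (i + c) := by
      intro i
      refine Fintype.sum_equiv (Equiv.addLeft i) _ _ fun iB => ?_
      have : i + (i + iB) = iB := by
        rw [← add_assoc]
        have : i + i = 0 := funext fun j => zmod_two_add_self _
        rw [this, zero_add]
      simp only [Equiv.coe_addLeft, this]
    simp only [h1]
    rw [Finset.sum_comm, Finset.mul_sum]
    refine Finset.sum_congr rfl fun c _ => ?_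
    rw [← Finset.mul_sum, mul_left_comm]
    congr 1
    simp only [protocolProb, outcomeProb_eq_prod, QubitAttack.flipProb]
    rw [← Finset.mul_sum, Finset.prod_mul_distrib, mul_assoc]
    congr 1
    rw [Finset.prod_univ_sum, Fintype.piFinset_univ]
    simp only [Pi.add_apply, Finset.prod_const, Finset.card_univ, Fintype.card_fin, one_div,
      inv_pow]
  rw [hswap, hshift]
  congr 1
  have hfac := sum_mul_mul_prod_eq (bijective_sumElim_positions P)
    (w := fun j c => (A j).flipProb (P.1.2.2 j) c) (fun j => (A j).sum_flipProb _)
    (fun _ => 1) h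
  simp only [one_mul] at hfac
  rw [hfac, sum_prod_eq_one fun a => (A (infoPos P a)).sum_flipProb _, one_mul]
  simp only [P.testX_testXPos]

lemma eveKeyState_eq (v : Fin (r + m) → Fin n → ZMod 2) (A : ∀ j, QubitAttack (ι j))
    (P : BitPartition n nz nx) (ξ : Fin r → ZMod 2) (k : Fin m → ZMod 2) :
    eveKeyState v A P ξ k = ((2 : ℂ) ^ (n - (r + m)))⁻¹ •
      ∑ x ∈ parityCoset v (Fin.append ξ k), eveState (fun a => A (infoPos P a)) 0 x := by
  rw [eveKeyState, P.testX_comp_infoPos, parityCoset, Finset.sum_filter]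
  congr 1
  refine Finset.sum_congr rfl fun x _ => ?_
  congr 1
  rw [eq_iff_iff, funext_iff, funext_iff, Fin.forall_fin_add]
  simp only [Fin.append_left, Fin.append_right]
  rfl

end Protocol

/-! ### The expected trace distance -/

section Expected

variable {n nz nx : ℕ} {ι : Fin (n + nz + nx) → Type*} [∀ j, Fintype (ι j)]
  [∀ j, DecidableEq (ι j)] {r m : ℕ}

/-- Concavity of the square root under the uniform average, by Cauchy–Schwarz. -/
lemma sum_inv_card_mul_sqrt_le {α : Type*} [Fintype α] {f : α → ℝ} (hf : ∀ a, 0 ≤ f a) :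
    ∑ a, (Fintype.card α : ℝ)⁻¹ * Real.sqrt (f a) ≤
      Real.sqrt (∑ a, (Fintype.card α : ℝ)⁻¹ * f a) := by
  apply Real.le_sqrt_of_sq_le
  rw [← Finset.mul_sum, ← Finset.mul_sum, mul_pow]
  have h := sq_sum_le_card_mul_sum_sq (s := (Finset.univ : Finset α)) (f := fun a => Real.sqrt (f a))
  simp only [Real.sq_sqrt (hf _), Finset.card_univ] at h
  rcases Nat.eq_zero_or_pos (Fintype.card α) with h0 | hpos
  · simp [h0]
  · have hpos' : (0 : ℝ) < Fintype.card α := by exact_mod_cast hpos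
    calc ((Fintype.card α : ℝ)⁻¹) ^ 2 * (∑ a, Real.sqrt (f a)) ^ 2
        ≤ ((Fintype.card α : ℝ)⁻¹) ^ 2 * (Fintype.card α * ∑ a, f a) := by gcongr
      _ = _ := by field_simp

/-- The expected trace distance for two keys, if the distance of the code exceeds twice the weight
`(pax + ε) n`. -/
lemma expectedDelta_le {v : Fin (r + m) → Fin n → ZMod 2} (hv : LinearIndependent (ZMod 2) v)
    (A : ∀ j, QubitAttack (ι j)) (paz : ℝ) {pax ε : ℝ} (hε : 0 ≤ ε) (hn : 0 < n) (hnx : 0 < nx)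
    (hd : ∀ u : Fin n → ZMod 2, (hammingNorm u : ℝ) ≤ 2 * ((pax + ε) * n) →
      (hammingNorm u : ℕ∞) < keyDist r m v) (k k' : Fin m → ZMod 2) :
    expectedDelta v A paz pax k k' ≤
      2 * Real.exp (-(((nx : ℝ) / ((n : ℝ) + (nx : ℝ))) ^ 2 * (n : ℝ) * ε ^ 2)) := by
  set B : ℝ := (Fintype.card (BitPartition n nz nx) : ℝ)⁻¹ with hB
  set t : ℝ := (pax + ε) * n with ht
  set pass : (Fin nx → ZMod 2) → ℝ := fun d => if (hammingNorm d : ℝ) / nx ≤ pax then 1 else 0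
    with hpass
  set high : (Fin n → ZMod 2) → ℝ := fun d => if t < (hammingNorm d : ℝ) then 1 else 0 with hhigh
  -- A virtual probability: the INFO bits are sent in the `z` basis, yet the errors counted are
  -- those they would show in the `x` basis.
  set q : BitPartition n nz nx → ℝ := fun P =>
    ∑ d, high d * ∏ a, (A (infoPos P a)).flipProb 1 (d a) with hq
  set T : BitPartition n nz nx → ℝ := fun P =>
    ∑ d, pass d * ∏ a, (A (testXPos P a)).flipProb 1 (d a) with hT
  have hpass0 : ∀ d, 0 ≤ pass d := fun d => by simp only [hpass]; split_ifs <;> norm_num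
  have hpass1 : ∀ d, pass d ≤ 1 := fun d => by simp only [hpass]; split_ifs <;> norm_num
  have hhigh0 : ∀ d, 0 ≤ high d := fun d => by simp only [hhigh]; split_ifs <;> norm_num
  have hq0 : ∀ P, 0 ≤ q P := fun P => Finset.sum_nonneg fun d _ =>
    mul_nonneg (hhigh0 d) (Finset.prod_nonneg fun a _ => QubitAttack.flipProb_nonneg _ _ _)
  have hprod0 : ∀ (P : BitPartition n nz nx) (d : Fin nx → ZMod 2),
      0 ≤ ∏ a, (A (testXPos P a)).flipProb 1 (d a) := fun P d =>
    Finset.prod_nonneg fun a _ => QubitAttack.flipProb_nonneg _ _ _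
  have hT0 : ∀ P, 0 ≤ T P := fun P => Finset.sum_nonneg fun d _ =>
    mul_nonneg (hpass0 d) (hprod0 P d)
  have hT1 : ∀ P, T P ≤ 1 := by
    intro P
    rw [← sum_prod_eq_one fun a => (A (testXPos P a)).sum_flipProb 1]
    exact Finset.sum_le_sum fun d _ => mul_le_of_le_one_left (hprod0 P d) (hpass1 d)
  have hdelta : ∀ P ξ cz cb, deltaEve v A paz pax k k' P ξ cz cb ≤
      2 * Real.sqrt (q P) * pass cb := by
    intro P ξ cz cb
    rw [deltaEve]
    split_ifs with h
    · have h1 := traceNorm_sub_le_of_keyDist hv (fun a => A (infoPos P a)) hd ξ k k'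
      rw [← eveKeyState_eq, ← eveKeyState_eq] at h1
      have h2 : (∑ c with t < (hammingNorm c : ℝ), ∏ a, (A (infoPos P a)).flipProb 1 (c a)) =
          q P := by
        simp only [hq, hhigh, ite_mul, one_mul, zero_mul, Finset.sum_filter]
      rw [h2] at h1
      simp only [hpass, h.2, if_true]
      linarith
    · exact mul_nonneg (by positivity) (hpass0 cb)
  have hsum : expectedDelta v A paz pax k k' ≤ ∑ P, 2 * (B * (Real.sqrt (q P) * T P)) := by
    refine Finset.sum_le_sum fun P _ => ?_
    calc _ ≤ ∑ ξ, ∑ cz, ∑ cb, (2 * Real.sqrt (q P) * pass cb) * publicProb v A P ξ cz cb :=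
          Finset.sum_le_sum fun ξ _ => Finset.sum_le_sum fun cz _ => Finset.sum_le_sum fun cb _ =>
            mul_le_mul_of_nonneg_right (hdelta P ξ cz cb) (publicProb_nonneg v A P ξ cz cb)
      _ = 2 * (B * (Real.sqrt (q P) * T P)) := by
          rw [sum_mul_publicProb v A P fun cb => 2 * Real.sqrt (q P) * pass cb]
          simp only [mul_assoc, ← Finset.mul_sum, hT]
          ring
  have hB0 : 0 ≤ B := by positivity
  have hsqrt : ∑ P, 2 * (B * (Real.sqrt (q P) * T P)) ≤ 2 * Real.sqrt (∑ P, B * (q P * T P)) := by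
    rw [← Finset.mul_sum]
    refine mul_le_mul_of_nonneg_left ?_ (by norm_num)
    refine le_trans ?_ (sum_inv_card_mul_sqrt_le fun P => mul_nonneg (hq0 P) (hT0 P))
    refine Finset.sum_le_sum fun P _ => mul_le_mul_of_nonneg_left ?_ hB0
    rw [Real.sqrt_mul (hq0 P)]
    refine mul_le_mul_of_nonneg_left ?_ (Real.sqrt_nonneg _)
    -- `T ≤ √T` because `0 ≤ T ≤ 1`.
    apply Real.le_sqrt_of_sq_le
    nlinarith [hT0 P, hT1 P]
  set E : ℝ := Real.exp (-(2 * (((nx : ℝ) / ((n : ℝ) + (nx : ℝ))) ^ 2 * n * ε ^ 2))) with hE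
  have havg : ∑ P, B * (q P * T P) ≤ E := by
    -- With every position in basis `1`, the weight of `c` does not depend on `P`; the sums can be
    -- exchanged and the sampling bound used for each fixed `c`.
    have hfac : ∀ P, q P * T P = ∑ c : Fin (n + nz + nx) → ZMod 2,
        high (c ∘ infoPos P) * pass (c ∘ testXPos P) * ∏ j, (A j).flipProb 1 (c j) := fun P =>
      (sum_mul_mul_prod_eq (bijective_sumElim_positions P)
        (w := fun j c => (A j).flipProb 1 c) (fun j => (A j).sum_flipProb _) high pass).symm
    simp only [hfac]
    rw [← Finset.mul_sum, Finset.sum_comm]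
    have hc : ∀ c : Fin (n + nz + nx) → ZMod 2,
        ∑ P : BitPartition n nz nx, high (c ∘ infoPos P) * pass (c ∘ testXPos P) ≤
          Fintype.card (BitPartition n nz nx) * E := by
      intro c
      refine le_trans ?_ (card_filter_errorRate_le hn hnx hε c)
      rw [← Finset.sum_boole]
      refine Finset.sum_le_sum fun P _ => ?_
      simp only [hhigh, hpass]
      have hn' : (0 : ℝ) < n := by exact_mod_cast hn
      by_cases h1 : t < (hammingNorm (c ∘ infoPos P) : ℝ)
      · by_cases h2 : (hammingNorm (c ∘ testXPos P) : ℝ) / nx ≤ pax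
        · have h3 : pax + ε ≤ (hammingNorm (c ∘ infoPos P) : ℝ) / n := by
            rw [le_div_iff₀ hn']
            exact h1.le
          rw [if_pos h1, if_pos h2, if_pos (by linarith), one_mul]
        · rw [if_neg h2, mul_zero]
          split_ifs <;> norm_num
      · rw [if_neg h1, zero_mul]
        split_ifs <;> norm_num
    have hp0 : ∀ c : Fin (n + nz + nx) → ZMod 2, 0 ≤ ∏ j, (A j).flipProb 1 (c j) := fun c =>
      Finset.prod_nonneg fun a _ => QubitAttack.flipProb_nonneg _ _ _
    calc B * ∑ c : Fin (n + nz + nx) → ZMod 2, ∑ P : BitPartition n nz nx,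
          high (c ∘ infoPos P) * pass (c ∘ testXPos P) * ∏ j, (A j).flipProb 1 (c j)
        ≤ B * ∑ c : Fin (n + nz + nx) → ZMod 2, (Fintype.card (BitPartition n nz nx) * E) *
            ∏ j, (A j).flipProb 1 (c j) := by
          refine mul_le_mul_of_nonneg_left (Finset.sum_le_sum fun c _ => ?_) hB0
          rw [← Finset.sum_mul]
          exact mul_le_mul_of_nonneg_right (hc c) (hp0 c)
      _ = B * Fintype.card (BitPartition n nz nx) * E := by
          rw [← Finset.mul_sum, sum_prod_eq_one fun j => (A j).sum_flipProb 1]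
          ring
      _ ≤ E := by
          refine mul_le_of_le_one_left (Real.exp_pos _).le ?_
          rw [hB]
          exact inv_mul_le_one
  calc expectedDelta v A paz pax k k' ≤ 2 * Real.sqrt (∑ P, B * (q P * T P)) := hsum.trans hsqrt
    _ ≤ 2 * Real.sqrt E := by gcongr
    _ = _ := by
        rw [hE, ← Real.exp_half]
        congr 2
        ring

lemma traceNorm_zero {κ : Type*} [Fintype κ] [DecidableEq κ] :
    traceNorm (0 : Matrix κ κ ℂ) = 0 := by
  obtain ⟨W, -, hW⟩ := exists_traceNorm_eq_trace_mul (0 : Matrix κ κ ℂ)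
  rw [Matrix.mul_zero, Matrix.trace_zero] at hW
  exact_mod_cast hW

lemma expectedDelta_self (v : Fin (r + m) → Fin n → ZMod 2) (A : ∀ j, QubitAttack (ι j))
    (paz pax : ℝ) (k : Fin m → ZMod 2) : expectedDelta v A paz pax k k = 0 := by
  simp only [expectedDelta, deltaEve, sub_self, traceNorm_zero, mul_zero, ite_self, zero_mul,
    Finset.sum_const_zero]

/-- The comparison is made in `ℝ≥0∞`, since `keyDist` may be `⊤`; strictness comes from `hd`, so
that `l = δ * n` is allowed. -/
lemma lt_keyDist_of_ofReal_lt_div {v : Fin (r + m) → Fin n → ZMod 2} {δ : ℝ} (hδ : 0 < δ)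
    (hn : 0 < n) (hd : ENNReal.ofReal δ < (keyDist r m v : ℝ≥0∞) / (n : ℝ≥0∞)) {l : ℕ}
    (hl : (l : ℝ) ≤ δ * n) : (l : ℕ∞) < keyDist r m v := by
  have hn0 : (n : ℝ≥0∞) ≠ 0 := by exact_mod_cast hn.ne'
  rw [ENNReal.lt_div_iff_mul_lt (Or.inl hn0) (Or.inl (ENNReal.natCast_ne_top n))] at hd
  have h1 : (l : ℝ≥0∞) ≤ ENNReal.ofReal δ * n := by
    rw [← ENNReal.ofReal_natCast l, ← ENNReal.ofReal_natCast n, ← ENNReal.ofReal_mul hδ.le]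
    exact ENNReal.ofReal_le_ofReal hl
  exact_mod_cast h1.trans_lt hd

end Expected

end BB84InfoZ

end

theorem mainTheorem2 (δ R : ℝ) (hδ : 0 < δ) (hR : 0 < R)
    (S : Set ℕ) (r m : ℕ → ℕ) (v : ∀ n, Fin (r n + m n) → Fin n → ZMod 2)
    (hv : ∀ n ∈ S, LinearIndependent (ZMod 2) (v n))
    (hd : ∀ n ∈ S, ENNReal.ofReal δ < (BB84InfoZ.keyDist (r n) (m n) (v n) : ℝ≥0∞) / (n : ℝ≥0∞))
    (hm : ∀ n ∈ S, (m n : ℝ) / (n : ℝ) ≤ R)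
    (paz pax ε : ℝ) (hpaz : 0 < paz) (hpax : 0 < pax) (hε : 0 < ε) (hδε : pax + ε ≤ δ / 2)
    (n nz nx : ℕ) (hnS : n ∈ S) (hn : 0 < n) (hnz : 0 < nz) (hnx : 0 < nx)
    {ι : Fin (n + nz + nx) → Type*} [∀ j, Fintype (ι j)] [∀ j, DecidableEq (ι j)]
    (A : ∀ j, BB84InfoZ.QubitAttack (ι j)) (k k' : Fin (m n) → ZMod 2) :
    BB84InfoZ.expectedDelta (v n) A paz pax k k' ≤
      2 * R * (n : ℝ) * Real.exp (-(((nx : ℝ) / ((n : ℝ) + (nx : ℝ))) ^ 2 * (n : ℝ) * ε ^ 2)) := by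
  have hn' : (0 : ℝ) < n := by exact_mod_cast hn
  -- For `m n = 0` the factor `R * n` may be less than one, but the only key is the empty one.
  -- Otherwise `R * n ≥ m n ≥ 1` absorbs the missing factor.
  rcases Nat.eq_zero_or_pos (m n) with h0 | hpos
  · have hk : k = k' := funext fun i => absurd i.2 (by omega)
    rw [hk, BB84InfoZ.expectedDelta_self]
    positivity
  · have h1 : (1 : ℝ) ≤ R * n := by
      have h2 := (div_le_iff₀ hn').1 (hm n hnS)
      have h3 : (1 : ℝ) ≤ m n := by exact_mod_cast hpos
      linarith
    refine (BB84InfoZ.expectedDelta_le (hv n hnS) A paz hε.le hn hnx (fun u hu => ?_) k k').trans ?_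
    · refine BB84InfoZ.lt_keyDist_of_ofReal_lt_div hδ hn (hd n hnS) (hu.trans ?_)
      nlinarith
    · refine mul_le_mul_of_nonneg_right ?_ (Real.exp_pos _).le
      linarith
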